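/- Setup. Let $d\ge 2$, let $\mathcal A\subset\mathbb R^d$ be a finite set of actions with $\|a\|_2\le 1$ for all $a\in\mathcal A$, spanning $\mathbb R^d$, and let $\theta_*,\phi_*\in\mathbb R^d$, $\omega\in\mathbb R$ satisfy $\|\theta_*\|_2\le 1$, $\|\phi_*\|_2\le\omega$. Put $f(x)=x+\omega$. Selecting action $A_s\in\mathcal A$ in round $s$ yields the reward $X_s=\langle A_s,\theta_*\rangle+\eta_s$, where the noises $\eta_s$ are independent and $\eta_s\sim\mathcal N(0,f(\langle\phi_*,A_s\rangle))$. Let $\sigma_{\max}>0$ be such that $f(\langle\phi_*,a\rangle)\le\sigma_{\max}^2$ for all $a\in\mathcal A$, and let $\rho\ge 0$. Constants. For $C_1,C_2>0$, $m\in\mathbb N$ and $\delta>0$ put $$\alpha^{(1)}_m(\delta)=4\sqrt2\,\sigma_{\max}\sqrt{m+\log\delta^{-1}},\quad \alpha^{(2)}_m(\delta)=\sqrt{2m\,\sigma_{\max}^4\big((C_2^{-1}\log(C_1\delta^{-1}))^2+1\big)},\quad \alpha^{(3)}_m(\delta)=\sqrt{2m\,\sigma_{\max}^2\log(m\delta^{-1})},$$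 $$\zeta_m(\delta)=\alpha^{(2)}_m(\delta/3)+2\alpha^{(3)}_m(\delta/3)\,\alpha^{(1)}_m(\delta/3)+\alpha^{(1)}_m(\delta/3)^2 .$$ Let $C_3$ be a constant with $\zeta_m(\delta')\le C_3\,m\sqrt{\log m}\,\log(1/\delta')$ for all integers $m\ge2$ and all $\delta'\in(0,1/2]$. Given $\delta>0$, let $\tilde C$ be a constant, independent of the dimension, with $$\rho\,\sigma_{\max}\sqrt{2\log(4\delta^{-1})}+C_3\,m\sqrt{\log m}\,\log(4\delta^{-1})\le\tilde C\,m\sqrt{\log m}\,\log(\delta^{-1})\qquad\text{for all integers } m\ge2 .$$ Exploration phase of RISE. Let $Q^*$ be a G-optimal design: a minimizer of $g(Q)=\max_{a\in\mathcal A}a^\top\big(\sum_{b\in\mathcal A}Q(b)bb^\top\big)^{-1}a$ over the probability distributions $Q$ on $\mathcal A$ for which $\sum_bQ(b)bb^\top$ is nonsingular. For $\varepsilon>0$ every action $a$ is selected exactly $$n_a=\left\lceil\frac{\tilde C^2d^2\log(d)\log^2(\delta^{-1})\,g(Q^*)\,Q^*(a)}{\varepsilon^2}\right\rceil$$ times,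 in some fixed order $A_1,\dots,A_n$, where $n=\sum_{a\in\mathcal A}n_a$. With $V_n=\sum_{s=1}^nA_sA_s^\top$ the estimates are $$\hat\theta_n=V_n^{-1}\sum_{s=1}^nX_sA_s,\qquad \hat\phi_n=V_n^{-1}\sum_{s=1}^nf^{-1}\Big(\big(X_s-\langle\hat\theta_n,A_s\rangle\big)^2\Big)A_s .$$ Statement. There are absolute constants $C_1,C_2>0$ such that, for all $\varepsilon,\delta>0$ and all choices of the above objects, $$\mathbb P\Big(\big|\langle a,\phi_*-\rho\theta_*\rangle-\langle a,\hat\phi_n-\rho\hat\theta_n\rangle\big|\le\varepsilon\ \ \text{for all } a\in\mathcal A\Big)\ge1-\delta .$$ -/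

import Mathlib

open MeasureTheory ProbabilityTheory
open scoped Matrix

noncomputable section

namespace RISE

/-- The variance link `f x = x + ω`, a bijection of `ℝ`; its inverse is `(varLink ω).symm`. -/
def varLink (ω : ℝ) : ℝ ≃ ℝ := Equiv.addRight ω

/-- `α⁽¹⁾(δ)`, with `σ` playing the role of `σ_max`. -/
def alpha1 (σ : ℝ) (d : ℕ) (δ : ℝ) : ℝ :=
  4 * √2 * σ * √(d + Real.log δ⁻¹)

/-- `α⁽²⁾(δ)`. -/
def alpha2 (C₁ C₂ σ : ℝ) (d : ℕ) (δ : ℝ) : ℝ :=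
  √(2 * d * (σ ^ 2) ^ 2 * ((C₂⁻¹ * Real.log (C₁ * δ⁻¹)) ^ 2 + 1))

/-- `α⁽³⁾(δ)`. -/
def alpha3 (σ : ℝ) (d : ℕ) (δ : ℝ) : ℝ :=
  √(2 * d * σ ^ 2 * Real.log (d * δ⁻¹))

/-- `ζ(δ) = α⁽²⁾(δ/3) + 2 α⁽³⁾(δ/3) α⁽¹⁾(δ/3) + α⁽¹⁾(δ/3)²`. -/
def zeta (C₁ C₂ σ : ℝ) (d : ℕ) (δ : ℝ) : ℝ :=
  alpha2 C₁ C₂ σ d (δ / 3) + 2 * alpha3 σ d (δ / 3) * alpha1 σ d (δ / 3)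
    + alpha1 σ d (δ / 3) ^ 2

/-- `C₃` is a constant (independent of the dimension and of the confidence level) with
`ζ(δ) ≤ C₃ d √(log d) log δ⁻¹`. -/
def IsZetaConstant (C₁ C₂ σ C₃ : ℝ) : Prop :=
  ∀ m : ℕ, 2 ≤ m → ∀ δ : ℝ, 0 < δ → δ ≤ 1 / 2 →
    zeta C₁ C₂ σ m δ ≤ C₃ * m * √(Real.log m) * Real.log δ⁻¹

/-- `Ct` (the constant `C̃`) is independent of the dimension and satisfies
`ρ σ √(2 log (4 δ⁻¹)) + C₃ d √(log d) log (4 δ⁻¹) ≤ C̃ d √(log d) log δ⁻¹`. -/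
def IsSampleConstant (C₃ σ ρ δ Ct : ℝ) : Prop :=
  ∀ m : ℕ, 2 ≤ m →
    ρ * σ * √(2 * Real.log (4 * δ⁻¹)) + C₃ * m * √(Real.log m) * Real.log (4 * δ⁻¹)
      ≤ Ct * m * √(Real.log m) * Real.log δ⁻¹

section Design

variable {d : ℕ}

/-- The matrix `a aᵀ`. -/
def outer (a : EuclideanSpace ℝ (Fin d)) : Matrix (Fin d) (Fin d) ℝ :=
  Matrix.vecMulVec a.ofLp a.ofLp

/-- `∑ₐ Q(a) a aᵀ`. -/
def infoMatrix {A : Finset (EuclideanSpace ℝ (Fin d))} (Q : A → ℝ) :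
    Matrix (Fin d) (Fin d) ℝ :=
  ∑ a : A, Q a • outer a.1

/-- `g(Q) = max_{a ∈ A} aᵀ (∑_b Q(b) b bᵀ)⁻¹ a` (used for nonsingular information matrices). -/
def gValue {A : Finset (EuclideanSpace ℝ (Fin d))} (Q : A → ℝ) : ℝ :=
  ⨆ a : A, a.1.ofLp ⬝ᵥ ((infoMatrix Q)⁻¹ *ᵥ a.1.ofLp)

/-- Probability weights on `A` whose information matrix is nonsingular, i.e. the `Q` at which the
objective `g` is defined. -/
def IsDesign {A : Finset (EuclideanSpace ℝ (Fin d))} (Q : A → ℝ) : Prop :=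
  (∀ a, 0 ≤ Q a) ∧ ∑ a, Q a = 1 ∧ IsUnit (infoMatrix Q).det

/-- `Q` is a G-optimal design: it minimizes `g` over all designs. -/
def IsGOptimal {A : Finset (EuclideanSpace ℝ (Fin d))} (Q : A → ℝ) : Prop :=
  IsDesign Q ∧ ∀ Q' : A → ℝ, IsDesign Q' → gValue Q ≤ gValue Q'

/-- The number `n_a` of exploration rounds in which action `a` is selected. -/
def pullCount {A : Finset (EuclideanSpace ℝ (Fin d))} (Ct ε δ : ℝ) (Q : A → ℝ) (a : A) : ℕ :=
  ⌈Ct ^ 2 * d ^ 2 * Real.log d * Real.log δ⁻¹ ^ 2 * gValue Q * Q a / ε ^ 2⌉₊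

variable {n : ℕ}

/-- `V_n = ∑ₛ Aₛ Aₛᵀ`. -/
def designMatrix (act : Fin n → EuclideanSpace ℝ (Fin d)) : Matrix (Fin d) (Fin d) ℝ :=
  ∑ s, outer (act s)

/-- `V_n⁻¹ ∑ₛ yₛ Aₛ`. -/
def leastSquares (act : Fin n → EuclideanSpace ℝ (Fin d)) (y : Fin n → ℝ) :
    EuclideanSpace ℝ (Fin d) :=
  WithLp.toLp 2 ((designMatrix act)⁻¹ *ᵥ (∑ s, y s • (act s).ofLp))

/-- The estimate `θ̂_n` computed from the rewards `X`. -/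
def thetaHat (act : Fin n → EuclideanSpace ℝ (Fin d)) (X : Fin n → ℝ) :
    EuclideanSpace ℝ (Fin d) :=
  leastSquares act X

/-- The estimate `φ̂_n` computed from the rewards `X`: least squares on the values of `f⁻¹` at
the squared residuals. -/
def phiHat (ω : ℝ) (act : Fin n → EuclideanSpace ℝ (Fin d)) (X : Fin n → ℝ) :
    EuclideanSpace ℝ (Fin d) :=
  leastSquares act
    (fun s => (varLink ω).symm ((X s - inner ℝ (thetaHat act X) (act s)) ^ 2))

end Design

end RISE

end

/-! Whitening reduces the claim to a norm bound that does not see the action set. Let `V` be the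
design matrix and `S = ∑ v_s A_s A_sᵀ`, with `v_s` the noise variances. A single `W` with `W V Wᵀ =
1` and `W S Wᵀ` diagonal gives vectors `b_s = W A_s` whose coordinates are orthonormal as functions
of `s`. The mean error becomes `Y = ∑ η_s b_s`, with independent Gaussian coordinates of variance at
most `σ²`.

For an action `a` put `c = W a`. The residual is `η_s - r_s` with `r_s = ⟨b_s, Y⟩`, so the variance
error is `⟨c, ∑ b_s ((η_s - r_s)² - v_s)⟩`. Expanding the square and using Cauchy–Schwarz and Bessel
(`abs_estimation_error_le`) bounds the total error by `‖c‖` times a random quantity free of `a`;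
hence no union over actions. Since `‖c‖² = aᵀ V⁻¹ a`, the pull counts give `‖c‖ ≤ ε / B`, where `B =
C̃ d √(log d) log δ⁻¹` (`IsDesign.mul_dotProduct_inv_le`).

It remains to bound the random quantity by `B` (`measureReal_error_gt_le`, `sample_constant_ge`).
Four tail events suffice: `‖Y‖` at two levels, the leverage-weighted sum of `η_s²`, and the norm of
`∑ b_s (η_s² - v_s)`. The delicate one is `‖Y‖` in the term with `ρ`: the condition on `C̃` allows
only `ρ σ √(2 log (4/δ))` in dimension two, which requires the exact planar Gaussian tail. In higher
dimensions, independence of `C̃` from the dimension leaves room for a Chernoff bound. -/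

noncomputable section

namespace RISE

open Real Finset
open scoped NNReal ENNReal

/-! ### Exponential moments and tails of squared Gaussians -/

section Gaussian

/-- The exponential moment of the square of a centred Gaussian. -/
lemma integral_exp_mul_sq_gaussianReal (v : ℝ≥0) {t : ℝ} (h : 2 * t * v < 1) :
    ∫ x, exp (t * x ^ 2) ∂gaussianReal 0 v = (√(1 - 2 * t * v))⁻¹ := by
  by_cases hv : v = 0
  · simp [hv]
  have hv' : (0 : ℝ) < v := by positivity
  rw [integral_gaussianReal_eq_integral_smul hv]
  have hb : ∀ x : ℝ, gaussianPDFReal 0 v x • exp (t * x ^ 2)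
      = (√(2 * π * v))⁻¹ * exp (-(1 / (2 * v) - t) * x ^ 2) := fun x => by
    rw [gaussianPDFReal_def, smul_eq_mul, mul_assoc, ← exp_add]
    congr 2
    field_simp
    ring
  simp_rw [hb]
  rw [integral_const_mul, integral_gaussian]
  have h1 : π / (1 / (2 * v) - t) = (2 * π * v) * (1 - 2 * t * v)⁻¹ := by
    have : (1 / (2 * v) - t : ℝ) = (1 - 2 * t * v) / (2 * v) := by field_simp
    rw [this]
    have : (1 - 2 * t * v : ℝ) ≠ 0 := by linarith
    field_simp
  rw [h1, sqrt_mul (show 0 ≤ 2 * π * (v : ℝ) by positivity), sqrt_inv, ← mul_assoc,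
    inv_mul_cancel₀, one_mul]
  positivity

variable {Ω : Type*} [MeasurableSpace Ω] {P : Measure Ω}

lemma mgf_sq_of_hasLaw_gaussianReal {Y : Ω → ℝ} {v : ℝ≥0} (hY : HasLaw Y (gaussianReal 0 v) P)
    {t : ℝ} (h : 2 * t * v < 1) :
    mgf (fun x => Y x ^ 2) P t = (√(1 - 2 * t * v))⁻¹ := by
  rw [← integral_exp_mul_sq_gaussianReal v h, ← hY.integral_comp (by fun_prop)]
  rfl

/-- A non-integrable function has integral `0` by convention, so a positive moment certifies
integrability. -/
lemma integrable_exp_of_mgf_pos {Y : Ω → ℝ} {t : ℝ} (h : 0 < mgf Y P t) :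
    Integrable (fun x => exp (t * Y x)) P := by
  by_contra hc
  rw [mgf, integral_undef hc] at h
  exact lt_irrefl _ h

/-- The parameter `1 / (4σ²)` makes `2tv ≤ 1/2`, so `1 - 2tv` stays above `1/2`. -/
lemma mgf_sq_le_sqrt_two {Y : Ω → ℝ} {v : ℝ≥0} (hY : HasLaw Y (gaussianReal 0 v) P)
    {σ : ℝ} (hσ : 0 < σ) (hv : v ≤ σ ^ 2) :
    0 < mgf (fun x => Y x ^ 2) P (1 / (4 * σ ^ 2)) ∧
      mgf (fun x => Y x ^ 2) P (1 / (4 * σ ^ 2)) ≤ √2 := by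
  have h1 : 2 * (1 / (4 * σ ^ 2)) * (v : ℝ) ≤ 1 / 2 := by
    rw [show 2 * (1 / (4 * σ ^ 2)) * (v : ℝ) = (v / σ ^ 2) / 2 by field_simp; ring]
    have : (v : ℝ) / σ ^ 2 ≤ 1 := (div_le_one (by positivity)).2 hv
    linarith
  rw [mgf_sq_of_hasLaw_gaussianReal hY (by linarith)]
  refine ⟨inv_pos.2 (sqrt_pos.2 (by linarith)), ?_⟩
  rw [← sqrt_inv]
  refine sqrt_le_sqrt ?_
  rw [inv_le_comm₀ (by linarith) (by norm_num)]
  linarith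

/-- Chernoff bound for a sum of squares of independent centred Gaussians. -/
lemma measureReal_sum_sq_ge_le {d : ℕ} {Y : Fin d → Ω → ℝ} {v : Fin d → ℝ≥0}
    (hY : ∀ j, HasLaw (Y j) (gaussianReal 0 (v j)) P) (hind : iIndepFun Y P)
    {σ : ℝ} (hσ : 0 < σ) (hv : ∀ j, v j ≤ σ ^ 2) (t : ℝ) :
    P.real {x | t ≤ ∑ j, Y j x ^ 2} ≤ exp (d / 2 * log 2 - t / (4 * σ ^ 2)) := by
  have := hind.isProbabilityMeasure
  have hsq : iIndepFun (fun j x => Y j x ^ 2) P :=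
    hind.comp (fun _ y => y ^ 2) (fun _ => by fun_prop)
  have hm : mgf (∑ j, fun x => Y j x ^ 2) P (1 / (4 * σ ^ 2))
      = ∏ j, mgf (fun x => Y j x ^ 2) P (1 / (4 * σ ^ 2)) :=
    hsq.mgf_sum₀ (fun j => (hY j).aemeasurable.pow_const 2) univ
  have hpos : 0 < mgf (∑ j, fun x => Y j x ^ 2) P (1 / (4 * σ ^ 2)) := by
    rw [hm]
    exact prod_pos fun j _ => (mgf_sq_le_sqrt_two (hY j) hσ (hv j)).1
  have hle : mgf (∑ j, fun x => Y j x ^ 2) P (1 / (4 * σ ^ 2)) ≤ exp (d / 2 * log 2) := by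
    rw [hm]
    calc _ ≤ ∏ _j : Fin d, √2 := prod_le_prod
            (fun j _ => (mgf_sq_le_sqrt_two (hY j) hσ (hv j)).1.le)
            (fun j _ => (mgf_sq_le_sqrt_two (hY j) hσ (hv j)).2)
      _ = exp (d / 2 * log 2) := by
        rw [prod_const, card_univ, Fintype.card_fin, sqrt_eq_rpow, ← rpow_natCast,
          ← rpow_mul (by norm_num), rpow_def_of_pos (by norm_num)]
        congr 1
        ring
  have hch := measure_ge_le_exp_mul_mgf (μ := P) (X := ∑ j, fun x => Y j x ^ 2) t
    (t := 1 / (4 * σ ^ 2)) (by positivity) (integrable_exp_of_mgf_pos hpos)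
  simp only [Finset.sum_apply] at hch
  refine hch.trans ?_
  calc _ ≤ exp (-(1 / (4 * σ ^ 2)) * t) * exp (d / 2 * log 2) := by gcongr
    _ = _ := by
      rw [← exp_add]
      congr 1
      ring

/-- Tail bound for a weighted sum of squares of centred Gaussians, without independence. -/
lemma measureReal_weighted_sum_sq_ge_le [IsProbabilityMeasure P] {n : ℕ} {Y : Fin n → Ω → ℝ}
    {v : Fin n → ℝ≥0}
    (hY : ∀ s, HasLaw (Y s) (gaussianReal 0 (v s)) P)
    {σ : ℝ} (hσ : 0 < σ) (hv : ∀ s, v s ≤ σ ^ 2) {w : Fin n → ℝ} (hw : ∀ s, 0 ≤ w s)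
    {T : ℝ} (hT : 0 < T) (hwT : ∑ s, w s = T) (t : ℝ) :
    P.real {x | t ≤ ∑ s, w s * Y s x ^ 2} ≤ √2 * exp (-(t / (4 * T * σ ^ 2))) := by
  -- Jensen for `exp` with weights `w s / T` replaces the product formula, so no independence
  -- enters.
  have hpt : ∀ x, exp (1 / (4 * T * σ ^ 2) * ∑ s, w s * Y s x ^ 2)
      ≤ ∑ s, w s / T * exp (1 / (4 * σ ^ 2) * Y s x ^ 2) := fun x => by
    have := convexOn_exp.map_sum_le (t := univ) (w := fun s => w s / T)
      (p := fun s => 1 / (4 * σ ^ 2) * Y s x ^ 2) (fun s _ => div_nonneg (hw s) hT.le)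
      (by rw [← sum_div, hwT, div_self hT.ne']) (fun _ _ => Set.mem_univ _)
    simp only [smul_eq_mul] at this
    refine le_trans (le_of_eq ?_) this
    rw [mul_sum]
    congr 1
    refine sum_congr rfl fun s _ => ?_
    field_simp
  have hint : ∀ s, Integrable (fun x => exp (1 / (4 * σ ^ 2) * Y s x ^ 2)) P := fun s =>
    integrable_exp_of_mgf_pos (mgf_sq_le_sqrt_two (hY s) hσ (hv s)).1
  have hintR : Integrable (fun x => ∑ s, w s / T * exp (1 / (4 * σ ^ 2) * Y s x ^ 2)) P :=
    integrable_finsetSum _ fun s _ => (hint s).const_mul _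
  have hintL : Integrable (fun x => exp (1 / (4 * T * σ ^ 2) * ∑ s, w s * Y s x ^ 2)) P := by
    refine hintR.mono' ?_ (ae_of_all _ fun x => ?_)
    · have hYm := fun s => (hY s).aemeasurable
      exact AEMeasurable.aestronglyMeasurable (by fun_prop)
    · rw [norm_of_nonneg (exp_pos _).le]
      exact hpt x
  have hch := measure_ge_le_exp_mul_mgf (μ := P) (X := fun x => ∑ s, w s * Y s x ^ 2) t
    (t := 1 / (4 * T * σ ^ 2)) (by positivity) hintL
  refine hch.trans ?_
  have hm : mgf (fun x => ∑ s, w s * Y s x ^ 2) P (1 / (4 * T * σ ^ 2)) ≤ √2 := by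
    calc _ ≤ ∫ x, ∑ s, w s / T * exp (1 / (4 * σ ^ 2) * Y s x ^ 2) ∂P :=
          integral_mono hintL hintR hpt
      _ = ∑ s, w s / T * mgf (fun x => Y s x ^ 2) P (1 / (4 * σ ^ 2)) := by
        rw [integral_finsetSum _ fun s _ => (hint s).const_mul _]
        simp_rw [integral_const_mul]
        rfl
      _ ≤ ∑ s, w s / T * √2 := by
        gcongr with s
        · exact div_nonneg (hw s) hT.le
        · exact (mgf_sq_le_sqrt_two (hY s) hσ (hv s)).2
      _ = √2 := by rw [← sum_mul, ← sum_div, hwT, div_self hT.ne', one_mul]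
  calc _ ≤ exp (-(1 / (4 * T * σ ^ 2)) * t) * √2 := by gcongr
    _ = _ := by
      rw [mul_comm]
      congr 2
      ring

end Gaussian


/-! ### Sub-exponential tails of centred squares -/

section SubExponential

/-- Second-order Taylor bound for `log (1 - x)`. The linear term `x / 2` is the one that centring
the square cancels later. -/
lemma inv_sqrt_one_sub_le {x : ℝ} (hx : |x| ≤ 1 / 2) :
    (√(1 - x))⁻¹ ≤ exp (x / 2 + x ^ 2) := by
  have h1 : 0 < 1 - x := by linarith [le_abs_self x]
  have h := abs_log_sub_add_sum_range_le (show |x| < 1 by linarith) 1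
  simp only [sum_range_one, zero_add, pow_one, Nat.cast_zero, div_one, one_add_one_eq_two,
    sq_abs] at h
  have h2 : x ^ 2 / (1 - |x|) ≤ 2 * x ^ 2 := by
    rw [div_le_iff₀ (by linarith)]
    nlinarith [sq_nonneg x]
  have h3 : -(x + 2 * x ^ 2) ≤ log (1 - x) := by linarith [neg_abs_le (x + log (1 - x))]
  rw [← exp_log (inv_pos.2 (sqrt_pos.2 h1)), exp_le_exp, log_inv, log_sqrt h1.le]
  linarith

/-- Jensen's inequality for the convex function `t ↦ cosh √t`. -/
lemma cosh_sqrt_le_mean {d : ℕ} (hd : 0 < d) (z : Fin d → ℝ) {y : ℝ}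
    (hy : y ^ 2 = (∑ j, z j ^ 2) / d) : cosh y ≤ (∑ j, cosh (z j)) / d := by
  have hd' : (0 : ℝ) < d := by exact_mod_cast hd
  have hs : HasSum (fun k : ℕ => (∑ j, z j ^ (2 * k) / ((2 * k).factorial : ℝ)) / d)
      ((∑ j, cosh (z j)) / d) :=
    (hasSum_sum fun j _ => hasSum_cosh (z j)).div_const _
  refine hasSum_le (fun k => ?_) (hasSum_cosh y) hs
  rw [pow_mul, hy, ← sum_div, div_right_comm]
  gcongr
  -- The cosh series has nonnegative coefficients in `z²`, so the power mean inequality applies term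
  -- by term.
  have := pow_arith_mean_le_arith_mean_pow univ (fun _ : Fin d => (d : ℝ)⁻¹) (fun j => z j ^ 2)
    (fun _ _ => by positivity) (by simp [hd'.ne']) (fun _ _ => sq_nonneg _) k
  rw [← mul_sum, ← mul_sum, inv_mul_eq_div, inv_mul_eq_div] at this
  simpa only [pow_mul] using this

variable {Ω : Type*} [MeasurableSpace Ω] {P : Measure Ω}

/-- Exponential moment of a normalised combination of centred squares of Gaussians. -/
lemma mgf_sum_centred_sq {n : ℕ} {η : Fin n → Ω → ℝ} {v : Fin n → ℝ≥0}
    (hη : ∀ s, HasLaw (η s) (gaussianReal 0 (v s)) P) (hind : iIndepFun η P)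
    {σ : ℝ} (hσ : 0 < σ) (hv : ∀ s, v s ≤ σ ^ 2) {b : Fin n → ℝ} (hb : ∑ s, b s ^ 2 = 1) :
    0 < mgf (fun x => ∑ s, b s * (η s x ^ 2 - v s)) P (1 / (4 * σ ^ 2)) ∧
      mgf (fun x => ∑ s, b s * (η s x ^ 2 - v s)) P (1 / (4 * σ ^ 2)) ≤ exp (1 / 4) := by
  set l : ℝ := 1 / (4 * σ ^ 2) with hl
  have hbs : ∀ s, |b s| ≤ 1 := fun s => by
    rw [← sq_le_one_iff_abs_le_one, ← hb]
    exact single_le_sum (f := fun s => b s ^ 2) (fun _ _ => sq_nonneg _) (mem_univ s)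
  have hlv : ∀ s, l * v s ≤ 1 / 4 := fun s => by
    have : (v s : ℝ) / σ ^ 2 ≤ 1 := (div_le_one (by positivity)).2 (hv s)
    rw [hl, show 1 / (4 * σ ^ 2) * (v s : ℝ) = (v s / σ ^ 2) / 4 by field_simp]
    linarith
  have hlv0 : ∀ s, 0 ≤ l * v s := fun s => by positivity
  have habs : ∀ s, |2 * (l * b s) * v s| ≤ 1 / 2 := fun s => by
    rw [show 2 * (l * b s) * (v s : ℝ) = 2 * (l * v s) * b s by ring, abs_mul,
      abs_of_nonneg (by linarith [hlv0 s])]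
    nlinarith [hbs s, hlv s, hlv0 s, abs_nonneg (b s)]
  have hsingle : ∀ s, mgf (fun x => b s * (η s x ^ 2 - v s)) P l
      = exp (-(l * b s * v s)) * (√(1 - 2 * (l * b s) * v s))⁻¹ := fun s => by
    rw [← mgf_sq_of_hasLaw_gaussianReal (hη s)
      (by linarith [habs s, le_abs_self (2 * (l * b s) * v s)])]
    rw [mgf, mgf, ← integral_const_mul]
    refine integral_congr_ae (ae_of_all _ fun x => ?_)
    simp only
    rw [← exp_add]
    congr 1
    ring
  have hpos : ∀ s, 0 < mgf (fun x => b s * (η s x ^ 2 - v s)) P l := fun s => by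
    rw [hsingle]
    have := habs s
    have := le_abs_self (2 * (l * b s) * v s)
    exact mul_pos (exp_pos _) (inv_pos.2 (sqrt_pos.2 (by linarith)))
  have hle : ∀ s, mgf (fun x => b s * (η s x ^ 2 - v s)) P l ≤ exp (b s ^ 2 / 4) := fun s => by
    rw [hsingle]
    calc _ ≤ exp (-(l * b s * v s))
          * exp ((2 * (l * b s) * v s) / 2 + (2 * (l * b s) * v s) ^ 2) := by
          gcongr
          exact inv_sqrt_one_sub_le (habs s)
      _ ≤ _ := by
        rw [← exp_add, exp_le_exp]
        -- The linear terms cancel, leaving `4 (l v)² b² ≤ b² / 4`. These bounds multiply to `exp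
        -- (1/4)` because `∑ b² = 1`.
        have : (l * v s) ^ 2 ≤ (1 / 4) ^ 2 := pow_le_pow_left₀ (hlv0 s) (hlv s) 2
        nlinarith [sq_nonneg (b s)]
  have hm : mgf (fun x => ∑ s, b s * (η s x ^ 2 - v s)) P l
      = ∏ s, mgf (fun x => b s * (η s x ^ 2 - v s)) P l := by
    have hYm := fun s => (hη s).aemeasurable
    have := (hind.comp (fun s y => b s * (y ^ 2 - v s)) (fun _ => by fun_prop)).mgf_sum₀ (t := l)
      (fun s => by simp only [Function.comp_def]; fun_prop) univ
    refine Eq.trans ?_ this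
    congr 1
    ext x
    simp
  rw [hm]
  refine ⟨prod_pos fun s _ => hpos s, ?_⟩
  calc _ ≤ ∏ s, exp (b s ^ 2 / 4) := prod_le_prod (fun s _ => (hpos s).le) (fun s _ => hle s)
    _ = exp (1 / 4) := by rw [← exp_sum, ← sum_div, hb]

/-- Tail bound for the Euclidean norm of a vector of normalised combinations of centred squares
of Gaussians. -/
lemma measureReal_sum_sq_centred_sq_ge_le [IsProbabilityMeasure P] {n d : ℕ} (hd : 0 < d)
    {η : Fin n → Ω → ℝ} {v : Fin n → ℝ≥0}
    (hη : ∀ s, HasLaw (η s) (gaussianReal 0 (v s)) P) (hind : iIndepFun η P)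
    {σ : ℝ} (hσ : 0 < σ) (hv : ∀ s, v s ≤ σ ^ 2) {b : Fin n → Fin d → ℝ}
    (hb : ∀ j, ∑ s, b s j ^ 2 = 1) {t : ℝ} (ht : 0 ≤ t) :
    P.real {x | d * t ^ 2 ≤ ∑ j, (∑ s, b s j * (η s x ^ 2 - v s)) ^ 2}
      ≤ 2 * exp (1 / 4) * exp (-(t / (4 * σ ^ 2))) := by
  have hd' : (0 : ℝ) < d := by exact_mod_cast hd
  set l : ℝ := 1 / (4 * σ ^ 2) with hl
  have hl0 : 0 < l := by positivity
  set N : Fin d → Ω → ℝ := fun j x => ∑ s, b s j * (η s x ^ 2 - v s) with hN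
  have h1 := fun j => mgf_sum_centred_sq hη hind hσ hv (hb j)
  have h2 : ∀ j, 0 < mgf (N j) P (-l) ∧ mgf (N j) P (-l) ≤ exp (1 / 4) := fun j => by
    have := mgf_sum_centred_sq hη hind hσ hv (b := fun s => -b s j) (by simpa using hb j)
    have he : mgf (fun x => ∑ s, -b s j * (η s x ^ 2 - v s)) P l = mgf (N j) P (-l) := by
      simp only [mgf, hN, neg_mul, sum_neg_distrib, mul_neg]
    rwa [← hl, he] at this
  have hi1 := fun j => integrable_exp_of_mgf_pos (h1 j).1
  have hi2 := fun j => integrable_exp_of_mgf_pos (h2 j).1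
  have hcosh : ∀ j x, cosh (l * N j x) = (exp (l * N j x) + exp (-l * N j x)) / 2 := fun j x => by
    rw [cosh_eq, neg_mul]
  have hic : ∀ j, Integrable (fun x => cosh (l * N j x)) P := fun j => by
    simp_rw [hcosh]
    exact ((hi1 j).add (hi2 j)).div_const 2
  have hEc : ∀ j, ∫ x, cosh (l * N j x) ∂P ≤ exp (1 / 4) := fun j => by
    simp_rw [hcosh]
    rw [integral_div, integral_add (hi1 j) (hi2 j)]
    have e1 := (h1 j).2
    have e2 := (h2 j).2
    simp only [mgf] at e1 e2
    linarith
  have hiS : Integrable (fun x => (∑ j, cosh (l * N j x)) / d) P :=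
    (integrable_finsetSum _ fun j _ => hic j).div_const _
  have hES : ∫ x, (∑ j, cosh (l * N j x)) / d ∂P ≤ exp (1 / 4) := by
    rw [integral_div, integral_finsetSum _ fun j _ => hic j, div_le_iff₀ hd']
    calc _ ≤ ∑ _j : Fin d, exp (1 / 4) := sum_le_sum fun j _ => hEc j
      _ = _ := by simp [mul_comm]
  -- The coordinates `N j` may be dependent. Averaging `cosh (l N j)` over `j` needs only the
  -- marginal moments and, unlike a union bound, costs no factor `d`.
  have hsub : {x | d * t ^ 2 ≤ ∑ j, N j x ^ 2}
      ⊆ {x | cosh (l * t) ≤ (∑ j, cosh (l * N j x)) / d} := fun x hx => by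
    have hx' : d * t ^ 2 ≤ ∑ j, N j x ^ 2 := hx
    have hS0 : 0 ≤ (∑ j, N j x ^ 2) / d := by positivity
    refine le_trans ?_ (cosh_sqrt_le_mean hd (fun j => l * N j x)
      (y := l * √((∑ j, N j x ^ 2) / d)) ?_)
    · rw [cosh_le_cosh, abs_of_nonneg (by positivity), abs_of_nonneg (by positivity)]
      gcongr
      exact le_sqrt_of_sq_le ((le_div_iff₀ hd').2 (by linarith))
    · rw [mul_pow, sq_sqrt hS0]
      simp_rw [mul_pow]
      rw [← mul_sum, mul_div_assoc]
  have hM := mul_meas_ge_le_integral_of_nonneg (μ := P)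
    (ae_of_all _ fun x => by positivity) hiS (cosh (l * t))
  have hc : exp (l * t) / 2 ≤ cosh (l * t) := by
    rw [cosh_eq]
    linarith [exp_pos (-(l * t))]
  have h3 : P.real {x | d * t ^ 2 ≤ ∑ j, N j x ^ 2}
      ≤ P.real {x | cosh (l * t) ≤ (∑ j, cosh (l * N j x)) / d} := measureReal_mono hsub
  have h4 : exp (l * t) / 2 * P.real {x | d * t ^ 2 ≤ ∑ j, N j x ^ 2} ≤ exp (1 / 4) :=
    calc _ ≤ cosh (l * t) * P.real {x | cosh (l * t) ≤ (∑ j, cosh (l * N j x)) / d} := by gcongr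
      _ ≤ _ := hM.trans hES
  rw [show t / (4 * σ ^ 2) = l * t by rw [hl]; ring, exp_neg]
  rw [← div_eq_mul_inv, le_div_iff₀ (exp_pos _)]
  linarith

end SubExponential

/-! ### Exact planar Gaussian tail in polar coordinates -/

section Planar

lemma integral_Ioi_mul_exp_neg_half_sq (a : ℝ) :
    ∫ r in Set.Ioi a, r * exp (-(r ^ 2 / 2)) = exp (-(a ^ 2 / 2)) := by
  have hd : ∀ x ∈ Set.Ioi a, HasDerivAt (fun r : ℝ => -exp (-(r ^ 2 / 2)))
      (x * exp (-(x ^ 2 / 2))) x := fun x _ => by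
    convert! ((((hasDerivAt_id x).pow 2).div_const 2).fun_neg.exp).fun_neg using 1
    simp
    ring
  have ht : Filter.Tendsto (fun r : ℝ => -exp (-(r ^ 2 / 2))) Filter.atTop (nhds 0) := by
    rw [← neg_zero]
    refine (tendsto_exp_neg_atTop_nhds_zero.comp ?_).neg
    exact (Filter.tendsto_pow_atTop two_ne_zero).atTop_div_const two_pos
  have hi : IntegrableOn (fun r : ℝ => r * exp (-(r ^ 2 / 2))) (Set.Ioi a) := by
    have := (integrable_mul_exp_neg_mul_sq (b := 1 / 2) (by norm_num)).integrableOn (s := Set.Ioi a)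
    refine this.congr_fun (fun r _ => ?_) measurableSet_Ioi
    simp only
    congr 2
    ring
  rw [integral_Ioi_of_hasDerivAt_of_tendsto (by fun_prop) hd hi ht]
  ring

/-- The tail of the Euclidean norm of a standard Gaussian vector in the plane. -/
lemma prod_gaussianReal_sq_gt {t : ℝ} (ht : 0 ≤ t) :
    ((gaussianReal 0 1).prod (gaussianReal 0 1)).real {p : ℝ × ℝ | t < p.1 ^ 2 + p.2 ^ 2}
      = exp (-(t / 2)) := by
  have hms : MeasurableSet {p : ℝ × ℝ | t < p.1 ^ 2 + p.2 ^ 2} :=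
    measurableSet_lt (by fun_prop) (by fun_prop)
  have hg : ∀ x y : ℝ, gaussianPDFReal 0 1 x * gaussianPDFReal 0 1 y
      = (2 * π)⁻¹ * exp (-((x ^ 2 + y ^ 2) / 2)) := fun x y => by
    simp only [gaussianPDFReal_def, NNReal.coe_one, mul_one, sub_zero]
    rw [mul_mul_mul_comm, ← exp_add, ← mul_inv, mul_self_sqrt (by positivity)]
    congr 2
    ring
  have h1 : ((gaussianReal 0 1).prod (gaussianReal 0 1)) {p : ℝ × ℝ | t < p.1 ^ 2 + p.2 ^ 2}
      = ∫⁻ p in {p : ℝ × ℝ | t < p.1 ^ 2 + p.2 ^ 2},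
          ENNReal.ofReal ((2 * π)⁻¹ * exp (-((p.1 ^ 2 + p.2 ^ 2) / 2))) := by
    rw [gaussianReal_of_var_ne_zero 0 one_ne_zero, prod_withDensity (by fun_prop) (by fun_prop),
      withDensity_apply _ hms, ← Measure.volume_eq_prod]
    refine lintegral_congr fun p => ?_
    rw [gaussianPDF, gaussianPDF, ← ENNReal.ofReal_mul (gaussianPDFReal_nonneg _ _ _), hg]
  rw [Measure.real, h1, ← integral_eq_lintegral_of_nonneg_ae (ae_of_all _ fun p => by positivity)
    (by fun_prop), ← integral_indicator hms, ← integral_comp_polarCoord_symm]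
  have h2 : ∀ p ∈ polarCoord.target,
      p.1 • Set.indicator {p : ℝ × ℝ | t < p.1 ^ 2 + p.2 ^ 2}
        (fun p => (2 * π)⁻¹ * exp (-((p.1 ^ 2 + p.2 ^ 2) / 2))) (polarCoord.symm p)
      = Set.indicator (Set.Ioi √t) (fun r => r * exp (-(r ^ 2 / 2))) p.1 * (2 * π)⁻¹ := by
    rintro ⟨r, θ⟩ hp
    have hr : 0 < r := by simpa [polarCoord] using hp.1
    have hsq : (r * cos θ) ^ 2 + (r * sin θ) ^ 2 = r ^ 2 := by
      linear_combination r ^ 2 * (sin_sq_add_cos_sq θ)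
    simp only [polarCoord_symm_apply, Set.indicator_apply, Set.mem_ofPred_eq, hsq, Set.mem_Ioi,
      sqrt_lt' hr, smul_eq_mul]
    split_ifs <;> ring
  rw [setIntegral_congr_fun polarCoord.open_target.measurableSet h2, polarCoord_target,
    Measure.volume_eq_prod, setIntegral_prod_mul (f := Set.indicator (Set.Ioi √t)
      (fun r => r * exp (-(r ^ 2 / 2)))) (g := fun _ => (2 * π)⁻¹),
    setIntegral_indicator measurableSet_Ioi,
    Set.inter_eq_right.2 (Set.Ioi_subset_Ioi (sqrt_nonneg t)), integral_Ioi_mul_exp_neg_half_sq,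
    sq_sqrt ht]
  have : volume.real (Set.Ioo (-π) π) = 2 * π := by
    rw [measureReal_def, volume_Ioo, ENNReal.toReal_ofReal (by linarith [pi_pos])]
    ring
  rw [setIntegral_const, this, smul_eq_mul, mul_inv_cancel₀ (by positivity), mul_one]

variable {Ω : Type*} [MeasurableSpace Ω] {P : Measure Ω}

/-- Tail bound for the Euclidean norm of a pair of independent centred Gaussians. -/
lemma measureReal_sq_add_sq_gt_le [IsProbabilityMeasure P] {Y Z : Ω → ℝ} {v w : ℝ≥0}
    (hY : HasLaw Y (gaussianReal 0 v) P) (hZ : HasLaw Z (gaussianReal 0 w) P)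
    (hind : IndepFun Y Z P) {σ : ℝ} (hσ : 0 < σ) (hv : v ≤ σ ^ 2) (hw : w ≤ σ ^ 2)
    {t : ℝ} (ht : 0 ≤ t) :
    P.real {x | t < Y x ^ 2 + Z x ^ 2} ≤ exp (-(t / (2 * σ ^ 2))) := by
  have hlaw : ∀ u : ℝ≥0, (gaussianReal 0 1).map (fun y => √u * y) = gaussianReal 0 u := fun u => by
    rw [gaussianReal_map_const_mul]
    rw [mul_zero]
    congr 1
    ext
    simp
  have hpair : HasLaw (fun x => (Y x, Z x)) ((gaussianReal 0 v).prod (gaussianReal 0 w)) P :=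
    hind.hasLaw_prod hY hZ
  have hms : MeasurableSet {p : ℝ × ℝ | t < p.1 ^ 2 + p.2 ^ 2} :=
    measurableSet_lt (by fun_prop) (by fun_prop)
  rw [hpair.measureReal_eq (p := fun p : ℝ × ℝ => t < p.1 ^ 2 + p.2 ^ 2) hms, ← hlaw v, ← hlaw w,
    Measure.map_prod_map _ _ (by fun_prop) (by fun_prop),
    map_measureReal_apply (by fun_prop) hms]
  -- Both variances are at most `σ²`, so the rescaled event lies in the rotationally symmetric one.
  calc _ ≤ ((gaussianReal 0 1).prod (gaussianReal 0 1)).real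
        {p : ℝ × ℝ | t / σ ^ 2 < p.1 ^ 2 + p.2 ^ 2} := by
        refine measureReal_mono fun p hp => ?_
        simp only [Set.mem_preimage, Set.mem_ofPred_eq, Prod.map_fst, Prod.map_snd, mul_pow,
          sq_sqrt (NNReal.coe_nonneg _)] at hp ⊢
        rw [div_lt_iff₀ (by positivity)]
        nlinarith [sq_nonneg p.1, sq_nonneg p.2]
    _ = _ := by
      rw [prod_gaussianReal_sq_gt (by positivity)]
      congr 1
      field_simp

end Planar


/-! ### Whitening, Bessel's inequality and the deterministic error bound -/

section LinearAlgebra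

open Matrix

variable {d n : ℕ}

lemma dotProduct_sum_outer_mulVec {ι : Type*} [Fintype ι] (w : ι → ℝ) (a : ι → Fin d → ℝ)
    (x y : Fin d → ℝ) :
    x ⬝ᵥ (∑ i, w i • vecMulVec (a i) (a i)) *ᵥ y = ∑ i, w i * ((a i ⬝ᵥ x) * (a i ⬝ᵥ y)) := by
  rw [sum_mulVec, dotProduct_sum]
  refine sum_congr rfl fun i _ => ?_
  rw [smul_mulVec, dotProduct_smul, vecMulVec_mulVec, op_smul_eq_smul, dotProduct_smul,
    dotProduct_comm x, smul_eq_mul, smul_eq_mul]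
  ring

lemma mul_sum_outer_mul_transpose {ι : Type*} [Fintype ι] (w : ι → ℝ) (a : ι → Fin d → ℝ)
    (W : Matrix (Fin d) (Fin d) ℝ) :
    W * (∑ i, w i • vecMulVec (a i) (a i)) * Wᵀ
      = ∑ i, w i • vecMulVec (W *ᵥ a i) (W *ᵥ a i) := by
  rw [mul_sum, sum_mul]
  refine sum_congr rfl fun i _ => ?_
  rw [Matrix.mul_smul, Matrix.smul_mul, mul_vecMulVec, vecMulVec_mul, vecMul_transpose]

lemma isHermitian_sum_outer {ι : Type*} [Fintype ι] (w : ι → ℝ) (a : ι → Fin d → ℝ) :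
    (∑ i, w i • vecMulVec (a i) (a i)).IsHermitian := by
  ext i j
  simp only [conjTranspose_apply, Matrix.sum_apply, Matrix.smul_apply, vecMulVec_apply, star_trivial]
  exact sum_congr rfl fun _ _ => by rw [mul_comm (a _ j)]

/-- A positive definite and a symmetric matrix are simultaneously diagonalisable by congruence. -/
lemma exists_simultaneous_diagonalization {V S : Matrix (Fin d) (Fin d) ℝ} (hV : V.PosDef)
    (hS : S.IsHermitian) :
    ∃ (W : Matrix (Fin d) (Fin d) ℝ) (v : Fin d → ℝ),
      W * V * Wᵀ = 1 ∧ W * S * Wᵀ = diagonal v := by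
  have key : ∀ {N : Matrix (Fin d) (Fin d) ℝ} (hN : N.IsHermitian),
      ∃ U : Matrix (Fin d) (Fin d) ℝ, U * Uᵀ = 1 ∧ U * N * Uᵀ = diagonal hN.eigenvalues := by
    intro N hN
    have h1 : (star (hN.eigenvectorUnitary : Matrix (Fin d) (Fin d) ℝ))
        * (hN.eigenvectorUnitary : Matrix (Fin d) (Fin d) ℝ) = 1 :=
      Unitary.coe_star_mul_self hN.eigenvectorUnitary
    set O : Matrix (Fin d) (Fin d) ℝ := (hN.eigenvectorUnitary).1 with hO
    have hst : star O = Oᵀ := by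
      rw [star_eq_conjTranspose, conjTranspose_eq_transpose_of_trivial]
    rw [hst] at h1
    refine ⟨Oᵀ, by rwa [transpose_transpose], ?_⟩
    have h2 := hN.spectral_theorem
    rw [Unitary.conjStarAlgAut_apply, ← hO, hst] at h2
    have h3 : (RCLike.ofReal ∘ hN.eigenvalues : Fin d → ℝ) = hN.eigenvalues := by
      ext; simp
    rw [h3] at h2
    rw [transpose_transpose]
    calc Oᵀ * N * O = Oᵀ * (O * diagonal hN.eigenvalues * Oᵀ) * O := by rw [← h2]
      _ = (Oᵀ * O) * diagonal hN.eigenvalues * (Oᵀ * O) := by simp only [Matrix.mul_assoc]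
      _ = _ := by rw [h1, Matrix.one_mul, Matrix.mul_one]
  -- Rotate `V` to its eigenbasis and rescale to the identity. A further rotation diagonalises the
  -- transformed `S` and preserves that identity.
  obtain ⟨U, -, hU⟩ := key hV.isHermitian
  set D : Matrix (Fin d) (Fin d) ℝ := diagonal fun i => (√(hV.isHermitian.eigenvalues i))⁻¹ with hD
  have hD1 : (D * U) * V * (D * U)ᵀ = 1 := by
    rw [transpose_mul]
    calc D * U * V * (Uᵀ * Dᵀ) = D * (U * V * Uᵀ) * Dᵀ := by simp only [Matrix.mul_assoc]
      _ = 1 := by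
        rw [hU, hD, diagonal_transpose, diagonal_mul_diagonal, diagonal_mul_diagonal,
          ← diagonal_one]
        congr 1
        ext i
        have hp := hV.eigenvalues_pos i
        have := mul_self_sqrt hp.le
        have h0 : √(hV.isHermitian.eigenvalues i) ≠ 0 := (sqrt_pos.2 hp).ne'
        field_simp
        linarith
  have hS' : ((D * U) * S * (D * U)ᵀ).IsHermitian := by
    have := isHermitian_mul_mul_conjTranspose (D * U) hS
    rwa [conjTranspose_eq_transpose_of_trivial] at this
  obtain ⟨O, hO1, hO2⟩ := key hS'
  refine ⟨O * (D * U), hS'.eigenvalues, ?_, ?_⟩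
  · calc O * (D * U) * V * (O * (D * U))ᵀ = O * ((D * U) * V * (D * U)ᵀ) * Oᵀ := by
          rw [transpose_mul O]; simp only [Matrix.mul_assoc]
      _ = 1 := by rw [hD1, Matrix.mul_one, hO1]
  · rw [← hO2, transpose_mul O]
    simp only [Matrix.mul_assoc]

lemma inv_eq_transpose_mul_of_congruence {V W : Matrix (Fin d) (Fin d) ℝ}
    (h : W * V * Wᵀ = 1) : V⁻¹ = Wᵀ * W := by
  refine inv_eq_left_inv ?_
  rw [Matrix.mul_assoc]
  exact mul_eq_one_comm.1 h

/-- Cauchy–Schwarz, with the parameters in the shape of the estimation error. -/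
lemma abs_sum_mul_le_sqrt_mul_sqrt (c f : Fin d → ℝ) :
    |∑ j, c j * f j| ≤ √(∑ j, c j ^ 2) * √(∑ j, f j ^ 2) := by
  rw [← sqrt_mul (sum_nonneg fun _ _ => sq_nonneg _)]
  exact abs_le_sqrt (sum_mul_sq_le_sq_mul_sq _ _ _)

lemma sum_sq_combination {b : Fin n → Fin d → ℝ}
    (hb : ∀ i j, ∑ s, b s i * b s j = if i = j then 1 else 0) (p : Fin d → ℝ) :
    ∑ s, (∑ j, b s j * p j) ^ 2 = ∑ j, p j ^ 2 := by
  calc ∑ s, (∑ j, b s j * p j) ^ 2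
      = ∑ s, ∑ i, ∑ j, (p i * p j) * (b s i * b s j) := by
        refine sum_congr rfl fun s _ => ?_
        rw [sq, sum_mul_sum]
        exact sum_congr rfl fun i _ => sum_congr rfl fun j _ => by ring
    _ = ∑ i, ∑ j, (p i * p j) * ∑ s, b s i * b s j := by
        rw [sum_comm]
        refine sum_congr rfl fun i _ => ?_
        rw [sum_comm]
        exact sum_congr rfl fun j _ => (mul_sum _ _ _).symm
    _ = ∑ j, p j ^ 2 := by simp [hb, sq]

/-- Bessel's inequality. -/
lemma sum_sq_coefficient_le {b : Fin n → Fin d → ℝ}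
    (hb : ∀ i j, ∑ s, b s i * b s j = if i = j then 1 else 0) (y : Fin n → ℝ) :
    ∑ j, (∑ s, b s j * y s) ^ 2 ≤ ∑ s, y s ^ 2 := by
  set p : Fin d → ℝ := fun j => ∑ s, b s j * y s with hp
  have h1 : ∑ s, y s * ∑ j, b s j * p j = ∑ j, p j ^ 2 := by
    simp_rw [mul_sum]
    rw [sum_comm]
    refine sum_congr rfl fun j _ => ?_
    rw [sq, hp, sum_mul]
    exact sum_congr rfl fun s _ => by ring
  have h2 : 0 ≤ ∑ s, (y s - ∑ j, b s j * p j) ^ 2 := sum_nonneg fun _ _ => sq_nonneg _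
  have h3 : ∑ s, (y s - ∑ j, b s j * p j) ^ 2
      = ∑ s, y s ^ 2 - 2 * ∑ s, y s * ∑ j, b s j * p j + ∑ s, (∑ j, b s j * p j) ^ 2 := by
    rw [mul_sum, ← sum_sub_distrib, ← sum_add_distrib]
    exact sum_congr rfl fun s _ => by ring
  rw [h3, h1, sum_sq_combination hb] at h2
  change ∑ j, p j ^ 2 ≤ _
  linarith

/-- Bound for the joint error of the variance and the mean estimate in whitened coordinates.
Here `Y` is the error of the mean estimate and `b` has orthonormal columns. -/
lemma abs_estimation_error_le {b : Fin n → Fin d → ℝ}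
    (hb : ∀ i j, ∑ s, b s i * b s j = if i = j then 1 else 0) (c Y : Fin d → ℝ)
    (η v : Fin n → ℝ) {ρ : ℝ} (hρ : 0 ≤ ρ) :
    |∑ j, c j * (∑ s, b s j * ((η s - ∑ i, b s i * Y i) ^ 2 - v s)) - ρ * ∑ j, c j * Y j|
      ≤ √(∑ j, c j ^ 2) * (√(∑ j, (∑ s, b s j * (η s ^ 2 - v s)) ^ 2)
        + 2 * (√(∑ s, (∑ j, b s j ^ 2) * η s ^ 2) * √(∑ j, Y j ^ 2)) + ∑ j, Y j ^ 2
        + ρ * √(∑ j, Y j ^ 2)) := by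
  set r : Fin n → ℝ := fun s => ∑ i, b s i * Y i with hr
  have hrY : ∑ s, r s ^ 2 = ∑ j, Y j ^ 2 := sum_sq_combination hb Y
  have hrs : ∀ s, r s ^ 2 ≤ (∑ j, b s j ^ 2) * ∑ j, Y j ^ 2 := fun s =>
    sum_mul_sq_le_sq_mul_sq _ _ _
  have hY0 : 0 ≤ ∑ j, Y j ^ 2 := sum_nonneg fun _ _ => sq_nonneg _
  have h1 := abs_sum_mul_le_sqrt_mul_sqrt c fun j => ∑ s, b s j * (η s ^ 2 - v s)
  have h2 := abs_sum_mul_le_sqrt_mul_sqrt c fun j => ∑ s, b s j * (η s * r s)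
  have h3 := abs_sum_mul_le_sqrt_mul_sqrt c fun j => ∑ s, b s j * r s ^ 2
  have h4 := abs_sum_mul_le_sqrt_mul_sqrt c Y
  -- Bessel removes the `b s j`, and `r_s² ≤ ‖b_s‖² ‖Y‖²` leaves the leverages `‖b_s‖²` as weights
  -- on `η_s²`.
  have e2 : √(∑ j, (∑ s, b s j * (η s * r s)) ^ 2)
      ≤ √(∑ s, (∑ j, b s j ^ 2) * η s ^ 2) * √(∑ j, Y j ^ 2) := by
    rw [← sqrt_mul (sum_nonneg fun s _ =>
      mul_nonneg (sum_nonneg fun _ _ => sq_nonneg _) (sq_nonneg _))]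
    refine sqrt_le_sqrt ((sum_sq_coefficient_le hb _).trans ?_)
    rw [sum_mul]
    refine sum_le_sum fun s _ => ?_
    rw [mul_pow]
    calc η s ^ 2 * r s ^ 2 ≤ η s ^ 2 * ((∑ j, b s j ^ 2) * ∑ j, Y j ^ 2) := by gcongr; exact hrs s
      _ = _ := by ring
  -- Bessel gives `∑ r_s⁴`, at most `(∑ r_s²)² = ‖Y‖⁴`.
  have e3 : √(∑ j, (∑ s, b s j * r s ^ 2) ^ 2) ≤ ∑ j, Y j ^ 2 := by
    refine sqrt_le_iff.2 ⟨hY0, (sum_sq_coefficient_le hb _).trans ?_⟩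
    rw [← hrY]
    exact sum_sq_le_sq_sum_of_nonneg fun s _ => sq_nonneg _
  have hsplit : ∑ j, c j * (∑ s, b s j * ((η s - r s) ^ 2 - v s)) - ρ * ∑ j, c j * Y j
      = ∑ j, c j * (∑ s, b s j * (η s ^ 2 - v s)) - 2 * ∑ j, c j * (∑ s, b s j * (η s * r s))
        + ∑ j, c j * (∑ s, b s j * r s ^ 2) - ρ * ∑ j, c j * Y j := by
    congr 1
    rw [mul_sum, ← sum_sub_distrib, ← sum_add_distrib]
    refine sum_congr rfl fun j _ => ?_
    rw [← mul_assoc, mul_comm 2, mul_assoc, ← mul_sub, ← mul_add, mul_sum _ _ (2 : ℝ),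
      ← sum_sub_distrib, ← sum_add_distrib]
    congr 1
    exact sum_congr rfl fun s _ => by ring
  rw [hsplit]
  have hc0 := sqrt_nonneg (∑ j, c j ^ 2)
  have f2 := mul_le_mul_of_nonneg_left e2 hc0
  have f3 := mul_le_mul_of_nonneg_left e3 hc0
  have f4 := mul_le_mul_of_nonneg_left h4 hρ
  have tri : ∀ p q u w : ℝ, |p - 2 * q + u - ρ * w| ≤ |p| + 2 * |q| + |u| + ρ * |w| := by
    intro p q u w
    have g1 := abs_sub (p - 2 * q + u) (ρ * w)
    have g2 := abs_add_le (p - 2 * q) u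
    have g3 := abs_sub p (2 * q)
    rw [abs_mul, abs_of_nonneg hρ] at g1
    rw [abs_mul, abs_of_pos (two_pos (α := ℝ))] at g3
    linarith
  refine (tri _ _ _ _).trans ?_
  linarith

end LinearAlgebra


/-! ### Independent Gaussian coordinates and the tail of their norm -/

section Combinations

variable {Ω : Type*} [MeasurableSpace Ω] {P : Measure Ω} [IsProbabilityMeasure P] {n d : ℕ}
  {η : Fin n → Ω → ℝ} {v : Fin n → ℝ≥0}

lemma covariance_sum_mul_gaussian (hη : ∀ s, HasLaw (η s) (gaussianReal 0 (v s)) P)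
    (hind : iIndepFun η P) (p q : Fin n → ℝ) :
    cov[fun x => ∑ s, p s * η s x, fun x => ∑ s, q s * η s x; P] = ∑ s, v s * (p s * q s) := by
  have hL : ∀ s, MemLp (η s) 2 P := fun s => (hη s).hasGaussianLaw.memLp_two
  rw [covariance_fun_sum_fun_sum (fun s => (hL s).const_mul _) (fun s => (hL s).const_mul _)]
  refine sum_congr rfl fun s _ => ?_
  rw [sum_eq_single_of_mem s (mem_univ s) fun t _ hts => by
    rw [covariance_const_mul_left, covariance_const_mul_right,
      (hind.indepFun hts.symm).covariance_eq_zero (hL s) (hL t), mul_zero, mul_zero]]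
  rw [covariance_const_mul_left, covariance_const_mul_right, covariance_self (hη s).aemeasurable,
    (hη s).variance_eq, variance_id_gaussianReal]
  ring

/-- Uncorrelated linear combinations of independent Gaussians are independent Gaussians. -/
lemma hasLaw_and_iIndepFun_combination (hη : ∀ s, HasLaw (η s) (gaussianReal 0 (v s)) P)
    (hind : iIndepFun η P) {b : Fin n → Fin d → ℝ} {u : Fin d → ℝ}
    (hb : ∀ i j, ∑ s, v s * (b s i * b s j) = if i = j then u i else 0) :
    (∀ j, HasLaw (fun x => ∑ s, b s j * η s x) (gaussianReal 0 (u j).toNNReal) P) ∧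
      iIndepFun (fun j x => ∑ s, b s j * η s x) P := by
  have hG : HasGaussianLaw (fun x => (η · x)) P :=
    iIndepFun.hasGaussianLaw (fun s => (hη s).hasGaussianLaw) hind
  have hY : HasGaussianLaw (fun x j => ∑ s, b s j * η s x) P := by
    convert! hG.map_fun (ContinuousLinearMap.pi fun j => ∑ s, b s j •
      (ContinuousLinearMap.proj (R := ℝ) (φ := fun _ : Fin n => ℝ) s)) using 1
    ext x j
    simp
  have hL : ∀ s, Integrable (η s) P := fun s => (hη s).hasGaussianLaw.integrable
  refine ⟨fun j => ⟨(hY.eval j).aemeasurable, ?_⟩, ?_⟩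
  · rw [(hY.eval j).map_eq_gaussianReal, ← covariance_self (hY.eval j).aemeasurable,
      covariance_sum_mul_gaussian hη hind, hb, if_pos rfl,
      integral_finsetSum _ fun s _ => (hL s).const_mul _]
    congr 1
    refine sum_eq_zero fun s _ => ?_
    rw [integral_const_mul, (hη s).integral_eq, integral_id_gaussianReal, mul_zero]
  · refine hY.iIndepFun_of_covariance_eq_zero fun i j hij => ?_
    rw [covariance_sum_mul_gaussian hη hind, hb, if_neg hij]

lemma three_halves_mul_log_two_le_log {m : ℕ} (hm : 3 ≤ m) : 3 / 2 * log 2 ≤ log m := by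
  have h : log ((2 : ℝ) ^ 3) ≤ log ((m : ℝ) ^ 2) := by
    refine log_le_log (by norm_num) ?_
    have : (3 : ℝ) ≤ m := by exact_mod_cast hm
    nlinarith
  rw [log_pow, log_pow] at h
  push_cast at h
  linarith

/-- Tail of the Euclidean norm of a vector of independent Gaussians at a level that is sharp in
dimension two and grows superlinearly with the dimension. -/
lemma measureReal_sum_sq_gt_le {Y : Fin d → Ω → ℝ} {u : Fin d → ℝ≥0} (hd : 2 ≤ d)
    (hY : ∀ j, HasLaw (Y j) (gaussianReal 0 (u j)) P) (hind : iIndepFun Y P)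
    {σ : ℝ} (hσ : 0 < σ) (hu : ∀ j, u j ≤ σ ^ 2) {L : ℝ} (hL : 2 * log 2 ≤ L) :
    P.real {x | 2 * σ ^ 2 * L * (d ^ 2 * log d / (4 * log 2)) < ∑ j, Y j x ^ 2}
      ≤ 2 * exp (-L) := by
  have hl2 : 0 < log 2 := log_pos (by norm_num)
  -- For `d = 2` the dimension factor equals `1` and the planar tail gives `exp (-L)`; the Chernoff
  -- bound would give only `exp (-L / 2)` up to a constant. For `d ≥ 3` the factor is at least `3 d²
  -- / 8`, enough for Chernoff.
  rcases hd.eq_or_lt with rfl | hd3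
  · have h := measureReal_sq_add_sq_gt_le (hY 0) (hY 1)
      (hind.indepFun (show (0 : Fin 2) ≠ 1 by decide)) hσ (hu 0) (hu 1)
      (t := 2 * σ ^ 2 * L) (by have := sq_nonneg σ; nlinarith)
    have e : 2 * σ ^ 2 * L * (((2 : ℕ) : ℝ) ^ 2 * log ((2 : ℕ) : ℝ) / (4 * log 2))
        = 2 * σ ^ 2 * L := by
      push_cast
      field_simp
      ring
    simp only [e, Fin.sum_univ_two]
    refine h.trans ?_
    rw [show 2 * σ ^ 2 * L / (2 * σ ^ 2) = L by field_simp]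
    linarith [exp_pos (-L)]
  · have hK : 3 / 8 * (d : ℝ) ^ 2 ≤ d ^ 2 * log d / (4 * log 2) := by
      rw [le_div_iff₀ (by positivity)]
      have := mul_le_mul_of_nonneg_left (three_halves_mul_log_two_le_log hd3) (sq_nonneg (d : ℝ))
      linarith
    have hd3' : (3 : ℝ) ≤ d := by exact_mod_cast hd3
    have hsub : P.real {x | 2 * σ ^ 2 * L * (d ^ 2 * log d / (4 * log 2)) < ∑ j, Y j x ^ 2}
        ≤ P.real {x | 2 * σ ^ 2 * L * (3 / 8 * d ^ 2) ≤ ∑ j, Y j x ^ 2} := by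
      refine measureReal_mono fun x hx => ?_
      rw [Set.mem_ofPred_eq] at hx ⊢
      refine le_trans ?_ hx.le
      have : 0 ≤ L := by linarith
      gcongr
    refine hsub.trans ((measureReal_sum_sq_ge_le hY hind hσ hu _).trans ?_)
    calc _ ≤ exp (log 2 + -L) := by
          rw [exp_le_exp, show 2 * σ ^ 2 * L * (3 / 8 * (d : ℝ) ^ 2) / (4 * σ ^ 2)
            = 3 / 16 * d ^ 2 * L by field_simp; ring]
          -- Both coefficients are nonnegative from `d = 3` on; `L ≥ 2 log 2` lets a multiple of `L`
          -- absorb the dimension term `d / 2 * log 2`.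
          have h1 : 0 ≤ (3 / 16 * (d : ℝ) ^ 2 - 1) * (L - 2 * log 2) :=
            mul_nonneg (by nlinarith) (by linarith)
          have h2 : 0 ≤ (3 / 8 * (d : ℝ) ^ 2 - d / 2 - 1) * log 2 :=
            mul_nonneg (by nlinarith) hl2.le
          linarith
      _ = 2 * exp (-L) := by rw [exp_add, exp_log two_pos]

end Combinations

/-! ### Least squares in whitened coordinates -/

section Estimators

open Matrix

variable {d n : ℕ}

lemma designMatrix_eq (act : Fin n → EuclideanSpace ℝ (Fin d)) :
    designMatrix act = ∑ s, (1 : ℝ) • vecMulVec (act s).ofLp (act s).ofLp := by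
  simp [designMatrix, outer]

/-- The least-squares estimate in whitened coordinates. -/
lemma inner_leastSquares {act : Fin n → EuclideanSpace ℝ (Fin d)}
    {W : Matrix (Fin d) (Fin d) ℝ} (hW : W * designMatrix act * Wᵀ = 1) (y : Fin n → ℝ)
    (a : EuclideanSpace ℝ (Fin d)) :
    inner ℝ a (leastSquares act y)
      = ∑ j, (W *ᵥ a.ofLp) j * ∑ s, (W *ᵥ (act s).ofLp) j * y s := by
  rw [EuclideanSpace.inner_eq_star_dotProduct, star_trivial, leastSquares,
    inv_eq_transpose_mul_of_congruence hW, ← mulVec_mulVec, dotProduct_comm, dotProduct_mulVec,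
    vecMul_transpose, mulVec_sum, dotProduct]
  refine sum_congr rfl fun j _ => ?_
  rw [Finset.sum_apply]
  congr 1
  refine sum_congr rfl fun s _ => ?_
  rw [mulVec_smul, Pi.smul_apply, smul_eq_mul, mul_comm]

lemma leastSquares_inner {act : Fin n → EuclideanSpace ℝ (Fin d)}
    (hV : IsUnit (designMatrix act).det) (θ : EuclideanSpace ℝ (Fin d)) :
    leastSquares act (fun s => inner ℝ θ (act s)) = θ := by
  have h : ∑ s, (inner ℝ θ (act s) : ℝ) • (act s).ofLp = designMatrix act *ᵥ θ.ofLp := by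
    rw [designMatrix_eq, sum_mulVec]
    refine sum_congr rfl fun s _ => ?_
    rw [one_smul, vecMulVec_mulVec, op_smul_eq_smul, EuclideanSpace.inner_eq_star_dotProduct,
      star_trivial]
  rw [leastSquares, h, mulVec_mulVec, nonsing_inv_mul _ hV, one_mulVec]

lemma inner_leastSquares_sub {act : Fin n → EuclideanSpace ℝ (Fin d)}
    {W : Matrix (Fin d) (Fin d) ℝ} (hW : W * designMatrix act * Wᵀ = 1)
    (hV : IsUnit (designMatrix act).det) (y : Fin n → ℝ) (θ a : EuclideanSpace ℝ (Fin d)) :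
    inner ℝ a (leastSquares act y - θ)
      = ∑ j, (W *ᵥ a.ofLp) j * ∑ s, (W *ᵥ (act s).ofLp) j * (y s - inner ℝ θ (act s)) := by
  nth_rw 1 [← leastSquares_inner hV θ]
  rw [inner_sub_right, inner_leastSquares hW, inner_leastSquares hW, ← sum_sub_distrib]
  refine sum_congr rfl fun j _ => ?_
  rw [← mul_sub, ← sum_sub_distrib]
  congr 1
  exact sum_congr rfl fun s _ => by ring

lemma sum_whitened_mul {act : Fin n → EuclideanSpace ℝ (Fin d)}
    {W D : Matrix (Fin d) (Fin d) ℝ} {w : Fin n → ℝ}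
    (h : W * (∑ s, w s • vecMulVec (act s).ofLp (act s).ofLp) * Wᵀ = D) (i j : Fin d) :
    ∑ s, w s * ((W *ᵥ (act s).ofLp) i * (W *ᵥ (act s).ofLp) j) = D i j := by
  rw [← h, mul_sum_outer_mul_transpose, Matrix.sum_apply]
  rfl

end Estimators

/-! ### Designs and confidence widths -/

section Design

open Matrix

variable {d n : ℕ} {A : Finset (EuclideanSpace ℝ (Fin d))} {Q : A → ℝ}

lemma infoMatrix_eq (Q : A → ℝ) :
    infoMatrix Q = ∑ a : A, Q a • vecMulVec a.1.ofLp a.1.ofLp := rfl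

lemma IsDesign.posDef (hQ : IsDesign Q) : (infoMatrix Q).PosDef := by
  have hs : (infoMatrix Q).PosSemidef := by
    refine .of_dotProduct_mulVec_nonneg (isHermitian_sum_outer _ _) fun x => ?_
    rw [star_trivial, infoMatrix_eq, dotProduct_sum_outer_mulVec]
    exact sum_nonneg fun a _ => mul_nonneg (hQ.1 a) (mul_self_nonneg _)
  exact hs.posDef_iff_isUnit.2 ((isUnit_iff_isUnit_det _).2 hQ.2.2)

lemma le_gValue (Q : A → ℝ) (a : A) :
    a.1.ofLp ⬝ᵥ ((infoMatrix Q)⁻¹ *ᵥ a.1.ofLp) ≤ gValue Q :=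
  le_ciSup (f := fun a : A => a.1.ofLp ⬝ᵥ ((infoMatrix Q)⁻¹ *ᵥ a.1.ofLp))
    (Set.finite_range _).bddAbove a

lemma IsDesign.gValue_pos (hd : 0 < d) (hQ : IsDesign Q) : 0 < gValue Q := by
  have hex : ∃ a : A, a.1.ofLp ≠ 0 := by
    by_contra! hc
    have h0 : infoMatrix Q = 0 := by
      rw [infoMatrix_eq]
      exact sum_eq_zero fun a _ => by rw [hc a, vecMulVec_zero, smul_zero]
    have hdet := hQ.2.2
    have : Nonempty (Fin d) := ⟨⟨0, hd⟩⟩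
    rw [h0, det_zero] at hdet
    exact not_isUnit_zero hdet
  obtain ⟨a, ha⟩ := hex
  have := hQ.posDef.inv.dotProduct_mulVec_pos ha
  rw [star_trivial] at this
  exact this.trans_le (le_gValue Q a)

lemma dotProduct_designMatrix_mulVec (act : Fin n → A) (x : Fin d → ℝ) :
    x ⬝ᵥ designMatrix (fun s => (act s).1) *ᵥ x
      = ∑ a : A, (Nat.card {s : Fin n // act s = a} : ℝ) * ((a.1.ofLp ⬝ᵥ x) * (a.1.ofLp ⬝ᵥ x)) := by
  classical
  rw [designMatrix_eq, dotProduct_sum_outer_mulVec, ← sum_fiberwise _ act]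
  refine sum_congr rfl fun a _ => ?_
  rw [Nat.card_eq_fintype_card, Fintype.card_subtype, ← nsmul_eq_mul, ← sum_const]
  refine sum_congr rfl fun s hs => ?_
  rw [(mem_filter.1 hs).2, one_mul]

lemma mul_infoMatrix_le_designMatrix {act : Fin n → A} {k : ℝ}
    (hact : ∀ a, k * Q a ≤ Nat.card {s : Fin n // act s = a}) (x : Fin d → ℝ) :
    k * (x ⬝ᵥ infoMatrix Q *ᵥ x) ≤ x ⬝ᵥ designMatrix (fun s => (act s).1) *ᵥ x := by
  rw [dotProduct_designMatrix_mulVec, infoMatrix_eq, dotProduct_sum_outer_mulVec, mul_sum]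
  refine sum_le_sum fun a _ => ?_
  rw [← mul_assoc]
  exact mul_le_mul_of_nonneg_right (hact a) (mul_self_nonneg _)

lemma IsDesign.designMatrix_posDef (hQ : IsDesign Q) {act : Fin n → A} {k : ℝ} (hk : 0 < k)
    (hact : ∀ a, k * Q a ≤ Nat.card {s : Fin n // act s = a}) :
    (designMatrix (fun s => (act s).1)).PosDef := by
  refine .of_dotProduct_mulVec_pos ?_ fun x hx => ?_
  · rw [designMatrix_eq]
    exact isHermitian_sum_outer _ _
  · have h := hQ.posDef.dotProduct_mulVec_pos hx
    rw [star_trivial] at h ⊢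
    exact (mul_pos hk h).trans_le (mul_infoMatrix_le_designMatrix hact x)

/-- The confidence width of an action under an allocation dominating `k • Q`. -/
lemma IsDesign.mul_dotProduct_inv_le (hQ : IsDesign Q) {act : Fin n → A} {k : ℝ} (hk : 0 < k)
    (hact : ∀ a, k * Q a ≤ Nat.card {s : Fin n // act s = a}) (a : A) :
    k * (a.1.ofLp ⬝ᵥ (designMatrix (fun s => (act s).1))⁻¹ *ᵥ a.1.ofLp) ≤ gValue Q := by
  set V := designMatrix (fun s => (act s).1) with hVdef
  have hVp : V.PosDef := hQ.designMatrix_posDef hk hact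
  set z := (infoMatrix Q)⁻¹ *ᵥ a.1.ofLp with hz
  set u := V⁻¹ *ᵥ a.1.ofLp with hu
  have hMz : infoMatrix Q *ᵥ z = a.1.ofLp := by
    rw [hz, mulVec_mulVec, mul_nonsing_inv _ hQ.2.2, one_mulVec]
  have hVu : V *ᵥ u = a.1.ofLp := by
    rw [hu, mulVec_mulVec, mul_nonsing_inv _ ((isUnit_iff_isUnit_det _).1 hVp.isUnit),
      one_mulVec]
  set q := a.1.ofLp ⬝ᵥ u with hq
  have huV : u ⬝ᵥ V *ᵥ u = q := by rw [hVu, dotProduct_comm]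
  have hq0 : 0 ≤ q := by
    rw [← huV]
    simpa using hVp.posSemidef.dotProduct_mulVec_nonneg u
  -- With `V u = a` and `M z = a`, `M` the information matrix, `q = uᵀ M z`. Cauchy–Schwarz for the
  -- form `M`, together with `k M ≤ V`, gives `k q² ≤ g(Q) q`.
  have hcs : q ^ 2 ≤ (z ⬝ᵥ infoMatrix Q *ᵥ z) * (u ⬝ᵥ infoMatrix Q *ᵥ u) := by
    have hzu : q = u ⬝ᵥ infoMatrix Q *ᵥ z := by rw [hMz, dotProduct_comm]
    rw [hzu]
    simp_rw [infoMatrix_eq, dotProduct_sum_outer_mulVec]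
    refine sum_sq_le_sum_mul_sum_of_sq_le_mul _
      (fun b _ => mul_nonneg (hQ.1 b) (mul_self_nonneg _))
      (fun b _ => mul_nonneg (hQ.1 b) (mul_self_nonneg _)) (fun b _ => le_of_eq (by ring))
  have hzg : z ⬝ᵥ infoMatrix Q *ᵥ z ≤ gValue Q := by
    rw [hMz, dotProduct_comm]
    exact le_gValue Q a
  have huM := mul_infoMatrix_le_designMatrix hact u
  rw [← hVdef, huV] at huM
  have huM0 : 0 ≤ u ⬝ᵥ infoMatrix Q *ᵥ u := by
    simpa using hQ.posDef.posSemidef.dotProduct_mulVec_nonneg u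
  have h1 : q ^ 2 ≤ gValue Q * (u ⬝ᵥ infoMatrix Q *ᵥ u) :=
    hcs.trans (mul_le_mul_of_nonneg_right hzg huM0)
  have hg0 : 0 ≤ gValue Q := by
    refine le_trans ?_ hzg
    simpa using hQ.posDef.posSemidef.dotProduct_mulVec_nonneg z
  rcases hq0.eq_or_lt with h0 | h0
  · rw [← h0, mul_zero]
    exact hg0
  · have h2 : k * q * q ≤ gValue Q * q := by nlinarith
    exact le_of_mul_le_mul_right h2 h0

end Design


/-! ### Comparison of the constants -/

section Constants

/-- Because `C̃` does not depend on the dimension, its condition at `m = 2` can be multiplied by `f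
= d √(log d) / (2 √(log 2))`. The terms with `C₃` and `C̃` become those of dimension `d`, while the
term with `ρ` gains the factor `f`, which is the level allowed for `‖Y‖`. -/
lemma sample_constant_ge {C₁ C₂ C₃ σ ρ δ Ct : ℝ} (h3 : IsZetaConstant C₁ C₂ σ C₃)
    (ht : IsSampleConstant C₃ σ ρ δ Ct) (hδ : 0 < δ) (hδ1 : δ < 1) {d : ℕ} (hd : 2 ≤ d) :
    ρ * (σ * √(2 * log (δ / 4)⁻¹ * (d ^ 2 * log d / (4 * log 2)))) + zeta C₁ C₂ σ d (δ / 4)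
      ≤ Ct * d * √(log d) * log δ⁻¹ := by
  have e : 4 * δ⁻¹ = (δ / 4)⁻¹ := by rw [inv_div]; ring
  have h2 := ht 2 le_rfl
  rw [e] at h2
  have hz := h3 d hd (δ / 4) (by linarith) (by linarith)
  have hl2 : 0 < log 2 := log_pos (by norm_num)
  have hs2 : 0 < √(log 2) := sqrt_pos.2 hl2
  have hL : 0 ≤ log (δ / 4)⁻¹ := log_nonneg ((one_le_inv₀ (by linarith)).2 (by linarith))
  have hld : 0 ≤ log (d : ℝ) := log_natCast_nonneg d
  set f : ℝ := d * √(log d) / (2 * √(log 2)) with hf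
  have hf0 : 0 ≤ f := by positivity
  have hfs : √(d ^ 2 * log d / (4 * log 2)) = f := by
    rw [sqrt_div (by positivity), sqrt_mul (by positivity), sqrt_mul (by norm_num),
      sqrt_sq (by positivity), show (4 : ℝ) = 2 ^ 2 by norm_num, sqrt_sq (by norm_num)]
  rw [sqrt_mul (by positivity), hfs]
  have h4 := mul_le_mul_of_nonneg_right h2 hf0
  have h5 : f * (2 * √(log 2)) = d * √(log d) := by rw [hf]; field_simp
  have h6 : C₃ * d * √(log d) * log (δ / 4)⁻¹
      = C₃ * ((2 : ℕ) : ℝ) * √(log ((2 : ℕ) : ℝ)) * log (δ / 4)⁻¹ * f := by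
    push_cast
    linear_combination -(C₃ * log (δ / 4)⁻¹) * h5
  have h7 : Ct * d * √(log d) * log δ⁻¹
      = Ct * ((2 : ℕ) : ℝ) * √(log ((2 : ℕ) : ℝ)) * log δ⁻¹ * f := by
    push_cast
    linear_combination -(Ct * log δ⁻¹) * h5
  rw [h6] at hz
  rw [h7]
  linarith

/-- The summand `1` inside `alpha2` gives strict positivity for every `δ`. -/
lemma zeta_pos {C₁ C₂ σ δ : ℝ} (hσ : 0 < σ) {d : ℕ} (hd : 0 < d) :
    0 < zeta C₁ C₂ σ d δ := by
  have hd' : (0 : ℝ) < d := by exact_mod_cast hd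
  have h2 : 0 < alpha2 C₁ C₂ σ d (δ / 3) := by unfold alpha2; positivity
  have h1 : 0 ≤ alpha1 σ d (δ / 3) := by unfold alpha1; positivity
  have h3 : 0 ≤ alpha3 σ d (δ / 3) := sqrt_nonneg _
  unfold zeta
  positivity

end Constants

/-! ### Union of the four tail events -/

section Concentration

variable {Ω : Type*} [MeasurableSpace Ω] {P : Measure Ω} [IsProbabilityMeasure P] {n d : ℕ}

/-- With probability at least `1 - δ`, the estimation error in whitened coordinates is at most
the width used in the sample size. -/
lemma measureReal_error_gt_le {η : Fin n → Ω → ℝ} {v : Fin n → ℝ≥0} (hd : 2 ≤ d)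
    (hη : ∀ s, HasLaw (η s) (gaussianReal 0 (v s)) P) (hind : iIndepFun η P)
    {σ : ℝ} (hσ : 0 < σ) (hv : ∀ s, v s ≤ σ ^ 2)
    {b : Fin n → Fin d → ℝ} {u : Fin d → ℝ}
    (hb : ∀ i j, ∑ s, b s i * b s j = if i = j then 1 else 0)
    (hbu : ∀ i j, ∑ s, v s * (b s i * b s j) = if i = j then u i else 0)
    {ρ δ : ℝ} (hρ : 0 ≤ ρ) (hδ : 0 < δ) (hδ1 : δ < 1) :
    P.real {x | ¬ (√(∑ j, (∑ s, b s j * (η s x ^ 2 - v s)) ^ 2)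
        + 2 * (√(∑ s, (∑ j, b s j ^ 2) * η s x ^ 2) * √(∑ j, (∑ s, b s j * η s x) ^ 2))
        + ∑ j, (∑ s, b s j * η s x) ^ 2 + ρ * √(∑ j, (∑ s, b s j * η s x) ^ 2)
      ≤ ρ * (σ * √(2 * log (δ / 4)⁻¹ * (d ^ 2 * log d / (4 * log 2))))
        + zeta 3 (1 / 4) σ d (δ / 4))} ≤ δ := by
  have hd0 : (0 : ℝ) < d := by exact_mod_cast (by omega : 0 < d)
  have hd2 : (2 : ℝ) ≤ d := by exact_mod_cast hd
  obtain ⟨hY, hYind⟩ := hasLaw_and_iIndepFun_combination hη hind hbu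
  have hu : ∀ j, ((u j).toNNReal : ℝ) ≤ σ ^ 2 := fun j => by
    have h1 : u j = ∑ s, v s * (b s j * b s j) := by rw [hbu, if_pos rfl]
    have h2 : u j ≤ σ ^ 2 := by
      calc u j ≤ ∑ s, σ ^ 2 * (b s j * b s j) := by
            rw [h1]
            exact sum_le_sum fun s _ => mul_le_mul_of_nonneg_right (hv s) (mul_self_nonneg _)
        _ = σ ^ 2 := by rw [← mul_sum, hb, if_pos rfl, mul_one]
    rw [Real.coe_toNNReal']
    exact max_le h2 (sq_nonneg _)
  have hcol : ∀ j, ∑ s, b s j ^ 2 = 1 := fun j => by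
    simpa [sq] using hb j j
  have htr : ∑ s, ∑ j, b s j ^ 2 = d := by
    rw [sum_comm]
    simp [hcol]
  -- `zeta` at `δ / 4` evaluates the three `alpha` terms at `γ`. The failure probabilities are `δ /
  -- 2` for the level `t1` and `γ = δ / 12` for each other event, in total `3δ / 4`.
  set γ : ℝ := δ / 4 / 3 with hγ
  have hγ0 : 0 < γ := by positivity
  have hγ1 : γ < 1 / 2 := by rw [hγ]; linarith
  have hinv : 1 < γ⁻¹ := (one_lt_inv₀ hγ0).2 (by linarith)
  have hl : 0 < log γ⁻¹ := log_pos hinv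
  have hexpl : exp (-log γ⁻¹) = γ := by rw [log_inv, neg_neg, exp_log hγ0]
  have h3l : 0 < log (3 * γ⁻¹) := log_pos (by linarith)
  have hdl : 0 < log (d * γ⁻¹) := log_pos (by nlinarith)
  set t4 : ℝ := 4 * σ ^ 2 * log (3 * γ⁻¹) with ht4
  set t1 : ℝ := 2 * σ ^ 2 * log (δ / 4)⁻¹ * (d ^ 2 * log d / (4 * log 2)) with ht1
  set t2 : ℝ := 8 * σ ^ 2 * (d + log γ⁻¹) with ht2
  set t3 : ℝ := 8 * d * σ ^ 2 * log (d * γ⁻¹) with ht3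
  have hE1 : P.real {x | t1 < ∑ j, (∑ s, b s j * η s x) ^ 2} ≤ δ / 2 := by
    refine (measureReal_sum_sq_gt_le hd hY hYind hσ hu ?_).trans (le_of_eq ?_)
    · rw [← log_rpow (by norm_num)]
      refine log_le_log (by positivity) ?_
      rw [inv_div, le_div_iff₀ hδ]
      norm_num
      linarith
    · rw [log_inv, neg_neg, exp_log (by positivity)]
      ring
  have hE2 : P.real {x | t2 ≤ ∑ j, (∑ s, b s j * η s x) ^ 2} ≤ γ := by
    refine (measureReal_sum_sq_ge_le hY hYind hσ hu t2).trans ?_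
    rw [← hexpl, exp_le_exp, ht2,
      show 8 * σ ^ 2 * (d + log γ⁻¹) / (4 * σ ^ 2) = 2 * (d + log γ⁻¹) by field_simp; ring]
    have := log_two_lt_d9
    nlinarith
  have hE3 : P.real {x | t3 ≤ ∑ s, (∑ j, b s j ^ 2) * η s x ^ 2} ≤ γ := by
    refine (measureReal_weighted_sum_sq_ge_le hη hσ hv
      (fun s => sum_nonneg fun j _ => sq_nonneg _) hd0 htr t3).trans ?_
    rw [ht3, show 8 * d * σ ^ 2 * log (d * γ⁻¹) / (4 * d * σ ^ 2)
        = log (d * γ⁻¹) + log (d * γ⁻¹) by field_simp; ring, neg_add, exp_add, ← log_inv,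
      exp_log (by positivity), mul_inv, inv_inv]
    have h2 : √2 ≤ 2 := by
      rw [sqrt_le_left (by norm_num)]
      norm_num
    have h4 : (d : ℝ)⁻¹ ≤ 1 := inv_le_one_of_one_le₀ (by linarith)
    have h5 : (d : ℝ)⁻¹ * γ ≤ γ := by nlinarith
    have h6 : (d : ℝ)⁻¹ * γ * ((d : ℝ)⁻¹ * γ) ≤ γ * γ := by gcongr
    calc _ ≤ 2 * (γ * γ) := by gcongr
      _ ≤ γ := by nlinarith
  have hE4 : P.real {x | d * t4 ^ 2 ≤ ∑ j, (∑ s, b s j * (η s x ^ 2 - v s)) ^ 2} ≤ γ := by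
    refine (measureReal_sum_sq_centred_sq_ge_le (by omega) hη hind hσ hv hcol
      (by positivity)).trans ?_
    rw [ht4, mul_div_cancel_left₀ _ (by positivity), ← log_inv, exp_log (by positivity), mul_inv,
      inv_inv]
    -- The prefactor `2 exp (1/4) ≤ 3` is what `C₁ = 3` absorbs; `C₂ = 1/4` is the rate in the
    -- exponent.
    have h1 : exp (1 / 4) ≤ 3 / 2 := by
      refine le_of_pow_le_pow_left₀ four_ne_zero (by norm_num) ?_
      rw [← exp_nat_mul]
      norm_num
      linarith [exp_one_lt_d9]
    nlinarith
  have hsub : {x | ¬ (√(∑ j, (∑ s, b s j * (η s x ^ 2 - v s)) ^ 2)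
        + 2 * (√(∑ s, (∑ j, b s j ^ 2) * η s x ^ 2) * √(∑ j, (∑ s, b s j * η s x) ^ 2))
        + ∑ j, (∑ s, b s j * η s x) ^ 2 + ρ * √(∑ j, (∑ s, b s j * η s x) ^ 2)
      ≤ ρ * (σ * √(2 * log (δ / 4)⁻¹ * (d ^ 2 * log d / (4 * log 2))))
        + zeta 3 (1 / 4) σ d (δ / 4))}
      ⊆ ({x | t1 < ∑ j, (∑ s, b s j * η s x) ^ 2}
          ∪ {x | t2 ≤ ∑ j, (∑ s, b s j * η s x) ^ 2})
        ∪ ({x | t3 ≤ ∑ s, (∑ j, b s j ^ 2) * η s x ^ 2}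
          ∪ {x | d * t4 ^ 2 ≤ ∑ j, (∑ s, b s j * (η s x ^ 2 - v s)) ^ 2}) := by
    intro x hx
    by_contra hc
    simp only [Set.mem_union, Set.mem_ofPred_eq, not_or, not_lt, not_le] at hc
    obtain ⟨⟨c1, c2⟩, c3, c4⟩ := hc
    refine hx ?_
    set D := ∑ j, (∑ s, b s j * η s x) ^ 2 with hD
    have g1 : √D ≤ σ * √(2 * log (δ / 4)⁻¹ * (d ^ 2 * log d / (4 * log 2))) := by
      rw [← sqrt_sq hσ.le, ← sqrt_mul (sq_nonneg _)]
      refine sqrt_le_sqrt (c1.trans (le_of_eq ?_))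
      rw [ht1]
      ring
    have ha1 : 0 ≤ alpha1 σ d γ := by unfold alpha1; positivity
    have ha3 : 0 ≤ alpha3 σ d γ := sqrt_nonneg _
    have ha1sq : alpha1 σ d γ ^ 2 = 32 * σ ^ 2 * (d + log γ⁻¹) := by
      rw [alpha1, mul_pow, mul_pow, mul_pow, sq_sqrt (by positivity), sq_sqrt (by positivity)]
      ring
    have g2 : D ≤ (alpha1 σ d γ / 2) ^ 2 := by
      rw [div_pow, ha1sq]
      linarith
    have g2' : √D ≤ alpha1 σ d γ / 2 := sqrt_le_iff.2 ⟨by positivity, g2⟩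
    have g3 : √(∑ s, (∑ j, b s j ^ 2) * η s x ^ 2) ≤ 2 * alpha3 σ d γ := by
      refine sqrt_le_iff.2 ⟨by positivity, c3.le.trans (le_of_eq ?_)⟩
      rw [alpha3, mul_pow, sq_sqrt (by positivity)]
      ring
    have g4 : √(∑ j, (∑ s, b s j * (η s x ^ 2 - v s)) ^ 2) ≤ alpha2 3 (1 / 4) σ d γ := by
      refine sqrt_le_sqrt (c4.le.trans ?_)
      have h0 : 0 ≤ d * (σ ^ 2) ^ 2 * (16 * log (3 * γ⁻¹) ^ 2 + 2) := by positivity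
      rw [ht4]
      norm_num
      linarith
    -- The level `t2` is `(alpha1 / 2)²` and `t3` is `(2 alpha3)²`, so the factors cancel in the
    -- cross term.
    have g5 : √(∑ s, (∑ j, b s j ^ 2) * η s x ^ 2) * √D
        ≤ 2 * alpha3 σ d γ * (alpha1 σ d γ / 2) :=
      mul_le_mul g3 g2' (sqrt_nonneg _) (by positivity)
    have g6 := mul_le_mul_of_nonneg_left g1 hρ
    rw [zeta, ← hγ]
    linarith [sq_nonneg (alpha1 σ d γ)]
  refine (measureReal_mono hsub).trans ((measureReal_union_le _ _).trans ?_)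
  have u1 := measureReal_union_le (μ := P) {x | t1 < ∑ j, (∑ s, b s j * η s x) ^ 2}
    {x | t2 ≤ ∑ j, (∑ s, b s j * η s x) ^ 2}
  have u2 := measureReal_union_le (μ := P) {x | t3 ≤ ∑ s, (∑ j, b s j ^ 2) * η s x ^ 2}
    {x | d * t4 ^ 2 ≤ ∑ j, (∑ s, b s j * (η s x ^ 2 - v s)) ^ 2}
  linarith

end Concentration

end RISE
end

/-! ### The main theorem -/

theorem mainTheorem3 :
    ∃ C₁ C₂ : ℝ, 0 < C₁ ∧ 0 < C₂ ∧
      ∀ (σmax C₃ ρ ε δ Ct : ℝ), 0 < σmax → RISE.IsZetaConstant C₁ C₂ σmax C₃ →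
        0 ≤ ρ → 0 < ε → 0 < δ → RISE.IsSampleConstant C₃ σmax ρ δ Ct →
      ∀ (d : ℕ), 2 ≤ d →
      ∀ (A : Finset (EuclideanSpace ℝ (Fin d))), (∀ a ∈ A, ‖a‖ ≤ 1) →
      ∀ (ω : ℝ) (θ φ : EuclideanSpace ℝ (Fin d)), ‖θ‖ ≤ 1 → ‖φ‖ ≤ ω →
        (∀ a ∈ A, RISE.varLink ω (inner ℝ φ a) ≤ σmax ^ 2) →
      ∀ (Q : A → ℝ), RISE.IsGOptimal Q →
      ∀ (n : ℕ) (act : Fin n → A),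
        (∀ a : A, Nat.card {s : Fin n // act s = a} = RISE.pullCount Ct ε δ Q a) →
      ∀ (Ω : Type*) [MeasurableSpace Ω] (P : Measure Ω) [IsProbabilityMeasure P]
        (η : Fin n → Ω → ℝ),
        (∀ s, HasLaw (η s)
          (gaussianReal 0 (RISE.varLink ω (inner ℝ φ (act s).1)).toNNReal) P) →
        iIndepFun η P →
      ∀ (X : Fin n → Ω → ℝ), (∀ s x, X s x = inner ℝ (act s).1 θ + η s x) →
        1 - δ ≤ P.real {x : Ω | ∀ a ∈ A,
          |inner ℝ a (φ - ρ • θ)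
            - inner ℝ a (RISE.phiHat ω (fun s => (act s).1) (fun s => X s x)
                - ρ • RISE.thetaHat (fun s => (act s).1) (fun s => X s x))| ≤ ε} := by
  refine ⟨3, 1 / 4, by norm_num, by norm_num, ?_⟩
  intro σ C₃ ρ ε δ Ct hσ hζ hρ hε hδ hCt d hd A hA ω θ φ _ hφ hσA Q hQ n act hact Ω _ P _ η hη
    hind X hX
  rcases le_or_gt 1 δ with hδ1 | hδ1
  · exact (by linarith : 1 - δ ≤ 0).trans measureReal_nonneg
  set B : ℝ := Ct * d * √(Real.log d) * Real.log δ⁻¹ with hB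
  have hBle := RISE.sample_constant_ge hζ hCt hδ hδ1 hd
  -- The sign of `Ct` is not assumed; `B` is positive because it dominates the positive `zeta`.
  have hB0 : 0 < B := by
    refine lt_of_lt_of_le ?_ hBle
    have := RISE.zeta_pos (C₁ := 3) (C₂ := 1 / 4) (δ := δ / 4) hσ (by omega : 0 < d)
    positivity
  have hg := hQ.1.gValue_pos (by omega)
  set k : ℝ := B ^ 2 * RISE.gValue Q / ε ^ 2 with hk
  have hk0 : 0 < k := by positivity
  have hcount : ∀ a, k * Q a ≤ Nat.card {s : Fin n // act s = a} := fun a => by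
    rw [hact, RISE.pullCount]
    refine le_trans (le_of_eq ?_) (Nat.le_ceil _)
    rw [hk, hB, mul_pow, mul_pow, mul_pow, Real.sq_sqrt (Real.log_natCast_nonneg d)]
    ring
  have hV := hQ.1.designMatrix_posDef hk0 hcount
  have hVdet := (Matrix.isUnit_iff_isUnit_det _).1 hV.isUnit
  set v : Fin n → NNReal := fun s => (RISE.varLink ω (inner ℝ φ (act s).1)).toNNReal with hv
  -- Since `|⟨φ, a⟩| ≤ ‖φ‖ ≤ ω`, the variance is nonnegative and `toNNReal` does not truncate it.
  have hvcoe : ∀ s, (v s : ℝ) = inner ℝ φ (act s).1 + ω := fun s => by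
    refine Real.coe_toNNReal _ ?_
    change 0 ≤ inner ℝ φ (act s).1 + ω
    have h1 := abs_real_inner_le_norm φ (act s).1
    have h2 := mul_le_mul_of_nonneg_left (hA _ (act s).2) (norm_nonneg φ)
    linarith [neg_abs_le (inner ℝ φ (act s).1 : ℝ)]
  have hvle : ∀ s, (v s : ℝ) ≤ σ ^ 2 := fun s => by
    rw [hvcoe]
    exact hσA _ (act s).2
  obtain ⟨W, u, hWV, hWS⟩ := RISE.exists_simultaneous_diagonalization hV
    (RISE.isHermitian_sum_outer (fun s => (v s : ℝ)) (fun s => (act s).1.ofLp))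
  set b : Fin n → Fin d → ℝ := fun s => W *ᵥ (act s).1.ofLp with hbdef
  have hb : ∀ i j, ∑ s, b s i * b s j = if i = j then 1 else 0 := fun i j => by
    have h := hWV
    rw [RISE.designMatrix_eq] at h
    have := RISE.sum_whitened_mul h i j
    simpa [Matrix.one_apply] using this
  have hbu : ∀ i j, ∑ s, v s * (b s i * b s j) = if i = j then u i else 0 := fun i j => by
    have := RISE.sum_whitened_mul hWS i j
    rwa [Matrix.diagonal_apply] at this
  have hbad := RISE.measureReal_error_gt_le hd hη hind hσ hvle hb hbu hρ hδ hδ1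
  -- The good and bad events cover the space, so subadditivity suffices and no measurability is
  -- needed.
  rw [sub_le_iff_le_add, ← probReal_univ (μ := P)]
  refine le_trans ?_ (add_le_add_right hbad _)
  refine (measureReal_mono fun x _ => ?_).trans (measureReal_union_le _ _)
  refine or_iff_not_imp_right.2 fun hx => ?_
  rw [Set.mem_ofPred_eq, not_not] at hx
  intro a ha
  set Y : Fin d → ℝ := fun j => ∑ s, b s j * η s x with hY
  have hθ : ∀ a', inner ℝ a' (RISE.thetaHat (fun s => (act s).1) (fun s => X s x) - θ)
      = ∑ j, (W *ᵥ a'.ofLp) j * Y j := fun a' => by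
    rw [RISE.thetaHat, RISE.inner_leastSquares_sub hWV hVdet]
    refine Finset.sum_congr rfl fun j _ => ?_
    congr 1
    refine Finset.sum_congr rfl fun s _ => ?_
    rw [hX, real_inner_comm, add_sub_cancel_left]
  have hres : ∀ s, X s x - inner ℝ (RISE.thetaHat (fun s => (act s).1) (fun s => X s x)) (act s).1
      = η s x - ∑ i, b s i * Y i := fun s => by
    have h : _ = ∑ i, b s i * Y i := hθ (act s).1
    rw [inner_sub_right, real_inner_comm] at h
    rw [hX]
    linarith
  have hφerr : inner ℝ a (RISE.phiHat ω (fun s => (act s).1) (fun s => X s x) - φ)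
      = ∑ j, (W *ᵥ a.ofLp) j * ∑ s, b s j * ((η s x - ∑ i, b s i * Y i) ^ 2 - v s) := by
    rw [RISE.phiHat, RISE.inner_leastSquares_sub hWV hVdet]
    refine Finset.sum_congr rfl fun j _ => ?_
    congr 1
    refine Finset.sum_congr rfl fun s _ => ?_
    -- Inverting the link subtracts `ω`, and `⟨φ, A_s⟩ + ω = v_s`, so each response error is the
    -- squared residual minus `v_s`.
    rw [hvcoe, hres]
    congr 1
    change _ + -ω - _ = _
    ring
  have herr := RISE.abs_estimation_error_le hb (W *ᵥ a.ofLp) Y (fun s => η s x)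
    (fun s => (v s : ℝ)) hρ
  rw [← hφerr, ← hθ] at herr
  have hsplit : inner ℝ a (φ - ρ • θ)
      - inner ℝ a (RISE.phiHat ω (fun s => (act s).1) (fun s => X s x)
        - ρ • RISE.thetaHat (fun s => (act s).1) (fun s => X s x))
      = -(inner ℝ a (RISE.phiHat ω (fun s => (act s).1) (fun s => X s x) - φ)
        - ρ * inner ℝ a (RISE.thetaHat (fun s => (act s).1) (fun s => X s x) - θ)) := by
    simp only [inner_sub_right, inner_smul_right]
    ring
  rw [hsplit, abs_neg]
  refine herr.trans ?_
  have hq : a.ofLp ⬝ᵥ (RISE.designMatrix fun s => (act s).1)⁻¹ *ᵥ a.ofLp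
      = ∑ j, (W *ᵥ a.ofLp) j ^ 2 := by
    rw [RISE.inv_eq_transpose_mul_of_congruence hWV, ← Matrix.mulVec_mulVec,
      Matrix.dotProduct_mulVec, Matrix.vecMul_transpose, dotProduct]
    exact Finset.sum_congr rfl fun j _ => (sq _).symm
  have hwidth := hQ.1.mul_dotProduct_inv_le hk0 hcount ⟨a, ha⟩
  rw [hq, hk] at hwidth
  -- With `k = B² g(Q) / ε²` the width bound reads `B² g(Q) ‖c‖² ≤ g(Q) ε²`; cancel `g(Q) > 0`.
  have hqB : √(∑ j, (W *ᵥ a.ofLp) j ^ 2) * B ≤ ε := by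
    refine abs_le_of_sq_le_sq' ?_ hε.le |>.2
    rw [mul_pow, Real.sq_sqrt (Finset.sum_nonneg fun _ _ => sq_nonneg _)]
    rw [div_mul_eq_mul_div, div_le_iff₀ (by positivity)] at hwidth
    refine le_of_mul_le_mul_left ?_ hg
    linarith
  refine le_trans ?_ hqB
  exact mul_le_mul_of_nonneg_left (hx.trans hBle) (Real.sqrt_nonneg _)
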